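/- Let $n,T\ge 1$, let $g^*(k)\in\mathbb C^n$ ($k=1,\dots,T$) have entries of modulus one, and suppose $\sum_{k=1}^{T-1}\|g^*(k)-g^*(k+1)\|_2^2\le S_T$. Let $\overline G^*\in\mathbb C^{nT\times n}$ be the matrix obtained by stacking the blocks $g^*(k)g^*(k)^{\mathsf H}-I_n$. Let $\eta\in[0,1]$ and $p(1),\dots,p(T)\in[0,1]$. (Outliers model.) Let $\mathcal H_k\sim ER(n,p(k))$, $k=1,\dots,T$, be independent Erdős–Rényi graphs on $\{1,\dots,n\}$. For $i<j$ put $A_{ij}(k)=0$ if $\{i,j\}$ is not an edge of $\mathcal H_k$; if it is an edge, then $A_{ij}(k)=g_i^*(k)\overline{g_j^*(k)}$ with probability $1-\eta$ and $A_{ij}(k)=e^{\iota\varphi_{ij}(k)}$ with probability $\eta$, where $\varphi_{ij}(k)\sim\mathrm{Unif}[0,2\pi)$; all choices over pairs $i<j$ and times $k$ are independent. Put $A_{ii}(k)=0$, $A_{ji}(k)=\overline{A_{ij}(k)}$, and let $A\in\mathbb C^{nT\times n}$ be the stack of $A(1),\dots,A(T)$. Let $v_1,\dots,v_T$ be real orthonormal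 eigenvectors of the Laplacian of the path graph on $T$ vertices, with eigenvalues $\lambda_1\ge\dots\ge\lambda_T$, and for $1\le\tau\le T$ let $\mathcal P_{\tau,n}=\big(\sum_{k=0}^{\tau-1}v_{T-k}v_{T-k}^\top\big)\otimes I_n$ and $\mathcal P^\perp_{\tau,n}=I_{nT}-\mathcal P_{\tau,n}$. Let $d(k)=(1-\eta)p(k)$, $D=\mathrm{blkdiag}(d(1)I_n,\dots,d(T)I_n)$, $\bar d=\frac1T\sum_{k=1}^T d(k)$, and assume that $D$ is $\mu$-smooth for some $\mu\ge1$: $$\|\mathcal P^\perp_{\tau,n}(D\overline G^*)\|_F^2\le\mu\bar d^2\|\mathcal P^\perp_{\tau,n}\overline G^*\|_F^2\qquad\text{for all }\tau\in\{1,\dots,T\}.$$ For $x\in[0,1]$ let $Q(x)=\|X\|_{\psi_2}=\sup_{q\ge1}q^{-1/2}(\mathbb E|X|^q)^{1/q}$, where $X$ is a centered Bernoulli variable with parameter $x$, and define $$p_{\max}=\max_kp(k),\quad V=\max_kp(k)(1-p(k)),\quad Q=\eta+Q(\eta)+\max_kQ(p(k)),$$ $$f=p_{\max}\eta+(1-\eta)^2V+p_{\max}V(1-\eta),\qquad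 \tilde f=f+Q^2\log(1/\delta),\qquad \rho=\frac{\mu\bar d^2T^2S_T}{n\tilde f}.$$ Then there are universal constants $C_1\in(0,1)$ and $C_2,C_3,C_4,C_5>0$ such that in every such setting and for every $\delta\in(0,C_1)$ the following holds for $\hat G=\mathcal P_{\tau^*,n}A$ with $$\tau^*=\min\{1+\lfloor\rho^{1/3}\rfloor,\,T\}$$ (when $\tilde f=0$, $\rho$ is read as $+\infty$, so that $\tau^*=T$, and the right-hand side of (a) is read as $0$). 1. With probability at least $1-\delta$, $$\|\hat G-D\overline G^*\|_F^2\le C_2\max\Big\{\frac{\mu\bar d^2nT^2S_T}{1+\rho^{2/3}},\ \mu\bar d^2nS_T\Big\}\mathbf 1_{\tau^*<T}+C_3\,\tilde f\,n^2\min\{1+\rho^{1/3},\,T\}.\tag{a}$$ 2. Suppose moreover that $\tilde f,\bar d,S_T>0$ and $$T\ge C_4\max\Big\{\Big(\frac{n\tilde f}{\mu\bar d^2S_T}\Big)^{1/2},\ \frac{\mu\bar d^2S_T}{n\tilde f}\Big\}.$$ Then (a) implies $$\|\hat G-D\overline G^*\|_F^2\le C_5\,\tilde f^{2/3}(\mu\bar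 d^2)^{1/3}n^{5/3}T^{2/3}S_T^{1/3},$$ and in particular this bound holds with probability at least $1-\delta$. -/

import Mathlib

open MeasureTheory ProbabilityTheory
open scoped unitInterval

namespace DynSync

noncomputable section

/-! ### Stacked matrices

A stacked matrix `concat(X(1), …, X(T)) ∈ ℂ^{nT × n}` has rows indexed by `(k, i) : Fin T × Fin n`. -/

/-- The squared Frobenius norm. -/
def frobSq {m n : Type*} [Fintype m] [Fintype n] (X : Matrix m n ℂ) : ℝ :=
  ∑ i, ∑ j, ‖X i j‖ ^ 2

/-- The block `g(k) g(k)ᴴ - I_n`. -/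
def GbarBlock {n T : ℕ} (g : Fin T → Fin n → ℂ) (k : Fin T) : Matrix (Fin n) (Fin n) ℂ :=
  Matrix.vecMulVec (g k) (star (g k)) - 1

/-- The stacked matrix with blocks `g(k) g(k)ᴴ - I_n`. -/
def Gbar {n T : ℕ} (g : Fin T → Fin n → ℂ) : Matrix (Fin T × Fin n) (Fin n) ℂ :=
  Matrix.of fun r j => GbarBlock g r.1 r.2 j

/-- `d(k) = (1 - η) p(k)`. -/
def dCoef {T : ℕ} (η : I) (p : Fin T → I) (k : Fin T) : ℝ := (1 - (η : ℝ)) * (p k : ℝ)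

/-- `blkdiag (d(1) I_n, …, d(T) I_n)`. -/
def Dmat (n : ℕ) {T : ℕ} (η : I) (p : Fin T → I) :
    Matrix (Fin T × Fin n) (Fin T × Fin n) ℂ :=
  Matrix.diagonal fun r => (dCoef η p r.1 : ℂ)

/-- The average of `d(1), …, d(T)`. -/
def dBar {T : ℕ} (η : I) (p : Fin T → I) : ℝ := (∑ k, dCoef η p k) / T

/-! ### Low-frequency projection -/

/-- The Laplacian of the path graph on `T` vertices. -/
def pathLaplacian (T : ℕ) : Matrix (Fin T) (Fin T) ℝ :=
  letI := Classical.decRel (SimpleGraph.pathGraph T).Adj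
  (SimpleGraph.pathGraph T).lapMatrix ℝ

/-- `v` is an orthonormal basis of eigenvectors of the path Laplacian, ordered so that the
corresponding eigenvalues `lam` are non-increasing. -/
structure IsSortedEigenbasis {T : ℕ} (lam : Fin T → ℝ)
    (v : OrthonormalBasis (Fin T) ℝ (EuclideanSpace ℝ (Fin T))) : Prop where
  antitone : Antitone lam
  eigen : ∀ k, (pathLaplacian T).mulVec (v k).ofLp = lam k • (v k).ofLp

/-- `∑ v_k v_kᵀ` over the last `τ` indices, i.e. over eigenvectors of the `τ` smallest eigenvalues. -/
def lowFreq {T : ℕ} (v : OrthonormalBasis (Fin T) ℝ (EuclideanSpace ℝ (Fin T))) (τ : ℕ) :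
    Matrix (Fin T) (Fin T) ℝ :=
  ∑ k ∈ Finset.univ.filter (fun k : Fin T => T ≤ (k : ℕ) + τ), Matrix.vecMulVec (v k).ofLp (v k).ofLp

/-- The projection `(∑ v_k v_kᵀ) ⊗ I_n`, the sum being over the `τ` smallest eigenvalues. -/
def proj {T : ℕ} (v : OrthonormalBasis (Fin T) ℝ (EuclideanSpace ℝ (Fin T))) (τ n : ℕ) :
    Matrix (Fin T × Fin n) (Fin T × Fin n) ℂ :=
  Matrix.kronecker ((lowFreq v τ).map Complex.ofReal) (1 : Matrix (Fin n) (Fin n) ℂ)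

/-! ### Smoothness assumptions -/

/-- `∑_{k=1}^{T-1} ‖g(k) - g(k+1)‖₂² ≤ S`. -/
def SignalSmooth {n T : ℕ} (g : Fin T → Fin n → ℂ) (S : ℝ) : Prop :=
  ∑ k : Fin (T - 1), ∑ i : Fin n,
    ‖g ⟨k, by omega⟩ i - g ⟨k + 1, by omega⟩ i‖ ^ 2 ≤ S

/-- The matrix `D` is `μ`-smooth. -/
def DSmooth {n T : ℕ} (v : OrthonormalBasis (Fin T) ℝ (EuclideanSpace ℝ (Fin T)))
    (g : Fin T → Fin n → ℂ) (η : I) (p : Fin T → I) (μ : ℝ) : Prop :=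
  ∀ τ : ℕ, 1 ≤ τ → τ ≤ T →
    frobSq ((1 - proj v τ n) * (Dmat n η p * Gbar g)) ≤
      μ * dBar η p ^ 2 * frobSq ((1 - proj v τ n) * Gbar g)

/-! ### The Outliers model -/

/-- Index of the unordered pair `{i, j}`, written with `i < j`, at time `k`. -/
abbrev PairIdx (n T : ℕ) : Type := Fin T × {q : Fin n × Fin n // q.1 < q.2}

/-- The uniform distribution on `[0, 2π)`. -/
def unifAngle : Measure ℝ := cond volume (Set.Ico 0 (2 * Real.pi))

/-- The random ingredients of the Outliers model. For every time `k` and every pair `i < j`,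
independently over all times and pairs: `{i, j}` is an edge of the graph `H k` with probability
`p k` (so the `H k` are independent Erdős–Rényi graphs), and, independently of this, its measurement
is an outlier with probability `η`, and an independent angle is drawn uniformly from `[0, 2π)`. -/
structure IsOutliersModel {Ω : Type*} [MeasurableSpace Ω] (P : Measure Ω) {n T : ℕ}
    (η : I) (p : Fin T → I) (H : Fin T → Ω → SimpleGraph (Fin n))
    (outlier : PairIdx n T → Ω → Prop) (φ : PairIdx n T → Ω → ℝ) : Prop where
  measurable_adj : ∀ e : PairIdx n T, Measurable fun ω => (H e.1 ω).Adj e.2.1.1 e.2.1.2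
  measurable_outlier : ∀ e, Measurable (outlier e)
  measurable_angle : ∀ e, Measurable (φ e)
  indep : iIndepFun
    (fun (e : PairIdx n T) ω => ((H e.1 ω).Adj e.2.1.1 e.2.1.2, outlier e ω, φ e ω)) P
  law : ∀ e : PairIdx n T,
    P.map (fun ω => ((H e.1 ω).Adj e.2.1.1 e.2.1.2, outlier e ω, φ e ω)) =
      (bernoulliMeasure True False (p e.1)).prod
        ((bernoulliMeasure True False η).prod unifAngle)

open Classical in
/-- The measurement for a pair `i < j` at time `k`: pure noise `exp(ι φ)` for an outlier edge,
`g_i conj(g_j)` for any other edge, and `0` for a non-edge. -/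
def pairObs {Ω : Type*} {n T : ℕ} (g : Fin T → Fin n → ℂ)
    (H : Fin T → Ω → SimpleGraph (Fin n)) (outlier : PairIdx n T → Ω → Prop)
    (φ : PairIdx n T → Ω → ℝ) (e : PairIdx n T) (ω : Ω) : ℂ :=
  if (H e.1 ω).Adj e.2.1.1 e.2.1.2 then
    if outlier e ω then Complex.exp (Complex.I * (φ e ω : ℂ))
    else g e.1 e.2.1.1 * star (g e.1 e.2.1.2)
  else 0

/-- The stacked measurement matrix: each block is Hermitian with zero diagonal. -/
def obs {Ω : Type*} {n T : ℕ} (g : Fin T → Fin n → ℂ)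
    (H : Fin T → Ω → SimpleGraph (Fin n)) (outlier : PairIdx n T → Ω → Prop)
    (φ : PairIdx n T → Ω → ℝ) (ω : Ω) : Matrix (Fin T × Fin n) (Fin n) ℂ :=
  Matrix.of fun r j =>
    if h : r.2 < j then pairObs g H outlier φ (r.1, ⟨(r.2, j), h⟩) ω
    else if h : j < r.2 then star (pairObs g H outlier φ (r.1, ⟨(j, r.2), h⟩) ω)
    else 0

/-! ### Quantities in the bound -/

/-- The subgaussian norm `sup_{q ≥ 1} q^{-1/2} (E |X|^q)^{1/q}`. -/
def psi2Norm {Ω : Type*} [MeasurableSpace Ω] (P : Measure Ω) (X : Ω → ℝ) : ℝ :=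
  ⨆ q : Set.Ici (1 : ℝ), (q : ℝ) ^ (-(1 / 2) : ℝ) * (∫ ω, |X ω| ^ (q : ℝ) ∂P) ^ (1 / (q : ℝ))

/-- The subgaussian norm of a centered Bernoulli variable, which takes the value `1 - x` with
probability `x` and `-x` with probability `1 - x`. -/
def Qber (x : I) : ℝ :=
  psi2Norm (bernoulliMeasure (1 - (x : ℝ)) (-(x : ℝ)) x) id

/-- The maximum of the `p(k)`. -/
def pMax {T : ℕ} (p : Fin T → I) : ℝ := ⨆ k, (p k : ℝ)

/-- The maximum of the `p(k) (1 - p(k))`. -/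
def Vmax {T : ℕ} (p : Fin T → I) : ℝ := ⨆ k, (p k : ℝ) * (1 - (p k : ℝ))

/-- `Q = η + Q(η) + max_k Q(p(k))`. -/
def Qtot {T : ℕ} (η : I) (p : Fin T → I) : ℝ := (η : ℝ) + Qber η + ⨆ k, Qber (p k)

/-- `f = p_max η + (1 - η)² V + p_max V (1 - η)`. -/
def fVar {T : ℕ} (η : I) (p : Fin T → I) : ℝ :=
  pMax p * η + (1 - (η : ℝ)) ^ 2 * Vmax p + pMax p * Vmax p * (1 - (η : ℝ))

/-- `f + Q² log (1/δ)`. -/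
def fTilde {T : ℕ} (η : I) (p : Fin T → I) (δ : ℝ) : ℝ :=
  fVar η p + Qtot η p ^ 2 * Real.log (1 / δ)

/-- The ratio `μ d̄² T² S / (n f̃)`. -/
def ratio (n : ℕ) {T : ℕ} (η : I) (p : Fin T → I) (μ S δ : ℝ) : ℝ :=
  μ * dBar η p ^ 2 * (T : ℝ) ^ 2 * S / (n * fTilde η p δ)

/-- The parameter `τ* = min {1 + ⌊(μ d̄² T² S / (n f̃))^{1/3}⌋, T}`. If `f̃ = 0` (no randomness at
all) the ratio is read as `+∞`, so that `τ* = T`. -/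
def tauStar (n : ℕ) {T : ℕ} (η : I) (p : Fin T → I) (μ S δ : ℝ) : ℕ :=
  if fTilde η p δ = 0 then T
  else min (1 + ⌊(ratio n η p μ S δ) ^ (1 / 3 : ℝ)⌋₊) T

/-- The squared error `‖P_{τ*,n} A - D Ḡ‖_F²` of the denoised matrix. -/
def sqError {Ω : Type*} {n T : ℕ} (v : OrthonormalBasis (Fin T) ℝ (EuclideanSpace ℝ (Fin T)))
    (g : Fin T → Fin n → ℂ) (η : I) (p : Fin T → I) (μ S δ : ℝ)
    (H : Fin T → Ω → SimpleGraph (Fin n)) (outlier : PairIdx n T → Ω → Prop)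
    (φ : PairIdx n T → Ω → ℝ) (ω : Ω) : ℝ :=
  frobSq (proj v (tauStar n η p μ S δ) n * obs g H outlier φ ω - Dmat n η p * Gbar g)

/-- Right-hand side of the general bound. -/
def generalBound (C₂ C₃ : ℝ) (n : ℕ) {T : ℕ} (η : I) (p : Fin T → I) (μ S δ : ℝ) : ℝ :=
  (if tauStar n η p μ S δ < T then
    C₂ * max (μ * dBar η p ^ 2 * n * (T : ℝ) ^ 2 * S / (1 + (ratio n η p μ S δ) ^ (2 / 3 : ℝ)))
      (μ * dBar η p ^ 2 * n * S)
  else 0) +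
  C₃ * fTilde η p δ * (n : ℝ) ^ 2 * min (1 + (ratio n η p μ S δ) ^ (1 / 3 : ℝ)) T

/-- Right-hand side of the simplified bound. -/
def simpleBound (C₅ : ℝ) (n : ℕ) {T : ℕ} (η : I) (p : Fin T → I) (μ S δ : ℝ) : ℝ :=
  C₅ * fTilde η p δ ^ (2 / 3 : ℝ) * (μ * dBar η p ^ 2) ^ (1 / 3 : ℝ) * (n : ℝ) ^ (5 / 3 : ℝ) *
    (T : ℝ) ^ (2 / 3 : ℝ) * S ^ (1 / 3 : ℝ)

end

end DynSync

/-!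
In the eigenbasis of the path Laplacian the squared error splits, by orthonormality, into a bias
`‖𝒫^⊥ D G*‖²` and a variance, the energy of the noise `A - D G*` in the `τ` lowest frequencies.

For the bias, smoothness of `D` reduces to `𝒫^⊥ G*`, whose `l`-th frequency carries energy at most
`1 / λ_l` times its share of the Dirichlet energy, which is at most `4 n S_T` in total. The
eigenvalue bound `τ² / (4 T²)` beyond the `τ` lowest frequencies comes from a Poincaré inequality
on blocks: cutting the path into fewer blocks than there are low frequencies leaves, by a dimension
count, a nonzero vector with vanishing block means.

For the variance, each of the at most `2 τ n²` real coordinates of the low-frequency noise is a sum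
over independent times, hence sub-Gaussian with parameter of order `Q²`. Jensen's inequality for
the exponential and Markov's inequality then bound the sum of their squares with no independence
between the coordinates. The choice of `τ*` balances the two contributions.
-/

open scoped NNReal

namespace DynSync

/-! ### Sub-Gaussian variables -/

lemma natCast_pow_self_le (m : ℕ) : (m : ℝ) ^ m ≤ Real.exp 1 ^ m * (m.factorial : ℝ) := by
  have h := Real.pow_div_factorial_le_exp (m : ℝ) (Nat.cast_nonneg m) m
  rw [div_le_iff₀ (by positivity)] at h
  rwa [← Real.exp_one_pow m] at h

lemma exp_le_add_exp_sq (x : ℝ) : Real.exp x ≤ x + Real.exp (x ^ 2) := by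
  have hsq := Real.add_one_le_exp (x ^ 2)
  rcases le_total |x| 1 with hx | hx
  · have := (abs_le.1 (Real.abs_exp_sub_one_sub_id_le hx)).2
    linarith
  rcases le_abs.1 hx with hx | hx
  · have : Real.exp x ≤ Real.exp (x ^ 2) := Real.exp_le_exp.2 (by nlinarith)
    linarith
  · have : Real.exp x ≤ 1 := Real.exp_le_one_iff.2 (by linarith)
    nlinarith

lemma integrable_and_integral_le_of_lintegral_le {Ω : Type*} [MeasurableSpace Ω] {P : Measure Ω}
    {f : Ω → ℝ} {C : ℝ} (hf : AEStronglyMeasurable f P) (hf0 : ∀ ω, 0 ≤ f ω) (hC : 0 ≤ C)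
    (h : ∫⁻ ω, ENNReal.ofReal (f ω) ∂P ≤ ENNReal.ofReal C) :
    Integrable f P ∧ ∫ ω, f ω ∂P ≤ C := by
  have hf0' : 0 ≤ᵐ[P] f := Filter.Eventually.of_forall hf0
  refine ⟨⟨hf, ?_⟩, ?_⟩
  · rw [hasFiniteIntegral_iff_ofReal hf0']
    exact h.trans_lt ENNReal.ofReal_lt_top
  · rw [integral_eq_lintegral_of_nonneg_ae hf0' hf]
    exact ENNReal.toReal_le_of_le_ofReal hC h

/-- Sub-Gaussian growth of the even moments, `E X^{2m} ≤ (K m)^m`. Up to universal constants this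
says that the sub-Gaussian norm of `X` is at most `√K`. -/
structure HasSubgaussianMoments {Ω : Type*} [MeasurableSpace Ω] (X : Ω → ℝ) (K : ℝ)
    (P : Measure Ω) : Prop where
  aestronglyMeasurable : AEStronglyMeasurable X P
  integrable_pow : ∀ m : ℕ, Integrable (fun ω => X ω ^ (2 * m)) P
  integral_pow_le : ∀ m : ℕ, ∫ ω, X ω ^ (2 * m) ∂P ≤ (K * m) ^ m

namespace HasSubgaussianMoments

variable {Ω : Type*} [MeasurableSpace Ω] {P : Measure Ω} {X Y : Ω → ℝ} {K K' : ℝ}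

lemma nonneg (hX : HasSubgaussianMoments X K P) : 0 ≤ K := by
  have h := (integral_nonneg fun ω => (even_two_mul 1).pow_nonneg (X ω)).trans
    (hX.integral_pow_le 1)
  simpa only [Nat.cast_one, mul_one, pow_one] using h

lemma mono (hX : HasSubgaussianMoments X K P) (hY : AEStronglyMeasurable Y P)
    (hYX : ∀ ω, |Y ω| ≤ |X ω|) (hK : K ≤ K') : HasSubgaussianMoments Y K' P := by
  have hpow (m : ℕ) (ω : Ω) : Y ω ^ (2 * m) ≤ X ω ^ (2 * m) := by
    simpa only [(even_two_mul m).pow_abs] using pow_le_pow_left₀ (abs_nonneg _) (hYX ω) (2 * m)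
  have hint (m : ℕ) : Integrable (fun ω => Y ω ^ (2 * m)) P := by
    refine (hX.integrable_pow m).mono' (hY.pow _) (.of_forall fun ω => ?_)
    rw [Real.norm_of_nonneg ((even_two_mul m).pow_nonneg _)]
    exact hpow m ω
  refine ⟨hY, hint, fun m => ?_⟩
  calc ∫ ω, Y ω ^ (2 * m) ∂P ≤ ∫ ω, X ω ^ (2 * m) ∂P :=
        integral_mono (hint m) (hX.integrable_pow m) (hpow m)
    _ ≤ (K * m) ^ m := hX.integral_pow_le m
    _ ≤ (K' * m) ^ m := by
        have := hX.nonneg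
        gcongr

lemma const [IsProbabilityMeasure P] (c : ℝ) :
    HasSubgaussianMoments (fun _ : Ω => c) (c ^ 2) P where
  aestronglyMeasurable := aestronglyMeasurable_const
  integrable_pow _ := integrable_const _
  integral_pow_le m := by
    rcases Nat.eq_zero_or_pos m with rfl | hm
    · simp
    · rw [integral_const, probReal_univ, one_smul, pow_mul]
      gcongr
      exact le_mul_of_one_le_right (sq_nonneg c) (by exact_mod_cast hm)

lemma const_mul (hX : HasSubgaussianMoments X K P) (a : ℝ) :
    HasSubgaussianMoments (fun ω => a * X ω) (a ^ 2 * K) P where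
  aestronglyMeasurable := hX.aestronglyMeasurable.const_mul a
  integrable_pow m := by
    simp only [mul_pow]
    exact (hX.integrable_pow m).const_mul _
  integral_pow_le m := by
    simp only [mul_pow]
    rw [integral_const_mul, pow_mul, mul_assoc, ← mul_pow K]
    gcongr
    exact hX.integral_pow_le m

lemma add (hX : HasSubgaussianMoments X K P) (hY : HasSubgaussianMoments Y K P) :
    HasSubgaussianMoments (fun ω => X ω + Y ω) (4 * K) P := by
  have hmeas := hX.aestronglyMeasurable.add hY.aestronglyMeasurable
  have hpow (m : ℕ) (ω : Ω) :
      (X ω + Y ω) ^ (2 * m) ≤ 2 ^ (2 * m - 1) * (X ω ^ (2 * m) + Y ω ^ (2 * m)) :=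
    (even_two_mul m).add_pow_le
  have hbound (m : ℕ) : Integrable
      (fun ω => 2 ^ (2 * m - 1) * (X ω ^ (2 * m) + Y ω ^ (2 * m))) P :=
    ((hX.integrable_pow m).add (hY.integrable_pow m)).const_mul _
  have hint (m : ℕ) : Integrable (fun ω => (X ω + Y ω) ^ (2 * m)) P := by
    refine (hbound m).mono' (hmeas.pow _) (.of_forall fun ω => ?_)
    rw [Real.norm_of_nonneg ((even_two_mul m).pow_nonneg _)]
    exact hpow m ω
  refine ⟨hmeas, hint, fun m => ?_⟩
  rcases Nat.eq_zero_or_pos m with rfl | hm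
  · simpa using hX.integral_pow_le 0
  calc ∫ ω, (X ω + Y ω) ^ (2 * m) ∂P
      ≤ 2 ^ (2 * m - 1) * (∫ ω, X ω ^ (2 * m) ∂P + ∫ ω, Y ω ^ (2 * m) ∂P) := by
        rw [← integral_add (hX.integrable_pow m) (hY.integrable_pow m), ← integral_const_mul]
        exact integral_mono (hint m) (hbound m) (hpow m)
    _ ≤ 2 ^ (2 * m - 1) * ((K * m) ^ m + (K * m) ^ m) := by
        gcongr
        exacts [hX.integral_pow_le m, hY.integral_pow_le m]
    _ = 2 ^ (2 * m) * (K * m) ^ m := by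
        rw [← two_mul, ← mul_assoc, ← pow_succ, Nat.sub_add_cancel (by lia)]
    _ = (4 * K * m) ^ m := by
        rw [pow_mul, ← mul_pow]
        norm_num [mul_assoc]

lemma comp_measurePreserving {Ω' : Type*} [MeasurableSpace Ω']
    {P' : Measure Ω'} {f : Ω' → Ω} (hX : HasSubgaussianMoments X K P)
    (hf : MeasurePreserving f P' P) : HasSubgaussianMoments (fun ω => X (f ω)) K P' where
  aestronglyMeasurable := hX.aestronglyMeasurable.comp_measurePreserving hf
  integrable_pow m := hf.integrable_comp_of_integrable (hX.integrable_pow m)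
  integral_pow_le m := by
    have hmeas := hX.aestronglyMeasurable.pow (2 * m)
    rw [← hf.map_eq] at hmeas
    rw [← integral_map (φ := f) (f := fun ω => X ω ^ (2 * m)) hf.aemeasurable hmeas, hf.map_eq]
    exact hX.integral_pow_le m

lemma lintegral_exp_mul_sq_le (hX : HasSubgaussianMoments X K P) {s : ℝ} (hs : 0 ≤ s)
    (hsK : s * (K * Real.exp 1) < 1) :
    ∫⁻ ω, ENNReal.ofReal (Real.exp (s * X ω ^ 2)) ∂P ≤
      ENNReal.ofReal (1 - s * (K * Real.exp 1))⁻¹ := by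
  have hK := hX.nonneg
  have hy : 0 ≤ s * (K * Real.exp 1) := by positivity
  have hterm (m : ℕ) : ∫⁻ ω, ENNReal.ofReal (s ^ m / m.factorial * X ω ^ (2 * m)) ∂P ≤
      ENNReal.ofReal ((s * (K * Real.exp 1)) ^ m) := by
    rw [← ofReal_integral_eq_lintegral_ofReal ((hX.integrable_pow m).const_mul _)
      (.of_forall fun ω => mul_nonneg (by positivity) ((even_two_mul m).pow_nonneg _)),
      integral_const_mul]
    refine ENNReal.ofReal_le_ofReal ?_
    calc s ^ m / m.factorial * ∫ ω, X ω ^ (2 * m) ∂P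
        ≤ s ^ m / m.factorial * (K * m) ^ m := by gcongr; exact hX.integral_pow_le m
      _ = s ^ m * K ^ m / m.factorial * (m : ℝ) ^ m := by ring
      _ ≤ s ^ m * K ^ m / m.factorial * (Real.exp 1 ^ m * m.factorial) := by
          gcongr; exact natCast_pow_self_le m
      _ = (s * (K * Real.exp 1)) ^ m := by rw [mul_pow, mul_pow]; field_simp
  have hseries (x : ℝ) : ENNReal.ofReal (Real.exp (s * x ^ 2)) =
      ∑' m : ℕ, ENNReal.ofReal (s ^ m / m.factorial * x ^ (2 * m)) := by
    have hpow (m : ℕ) : s ^ m / m.factorial * x ^ (2 * m) = (s * x ^ 2) ^ m / m.factorial := by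
      rw [mul_pow, pow_mul]; ring
    simp_rw [hpow]
    rw [← ENNReal.ofReal_tsum_of_nonneg (fun m => by positivity)
      (Real.summable_pow_div_factorial _),
      Real.exp_eq_exp_ℝ, NormedSpace.exp_eq_tsum_div]
  calc ∫⁻ ω, ENNReal.ofReal (Real.exp (s * X ω ^ 2)) ∂P
      = ∑' m : ℕ, ∫⁻ ω, ENNReal.ofReal (s ^ m / m.factorial * X ω ^ (2 * m)) ∂P := by
        simp_rw [hseries]
        exact lintegral_tsum fun m =>
          ((hX.integrable_pow m).const_mul _).aestronglyMeasurable.aemeasurable.ennreal_ofReal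
    _ ≤ ∑' m : ℕ, ENNReal.ofReal ((s * (K * Real.exp 1)) ^ m) := ENNReal.tsum_le_tsum hterm
    _ = ENNReal.ofReal (1 - s * (K * Real.exp 1))⁻¹ := by
        rw [← ENNReal.ofReal_tsum_of_nonneg (fun m => by positivity)
          (summable_geometric_of_lt_one hy hsK), tsum_geometric_of_lt_one hy hsK]

lemma integrable_exp_mul_sq (hX : HasSubgaussianMoments X K P) {s : ℝ} (hs : 0 ≤ s)
    (hsK : s * (K * Real.exp 1) < 1) : Integrable (fun ω => Real.exp (s * X ω ^ 2)) P :=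
  (integrable_and_integral_le_of_lintegral_le
    (Real.continuous_exp.comp_aestronglyMeasurable ((hX.aestronglyMeasurable.pow 2).const_mul s))
    (fun _ => by positivity) (inv_nonneg.2 (by linarith))
    (hX.lintegral_exp_mul_sq_le hs hsK)).1

lemma integral_exp_mul_sq_le (hX : HasSubgaussianMoments X K P) {s : ℝ} (hs : 0 ≤ s)
    (hsK : s * (K * Real.exp 1) ≤ 1 / 2) :
    ∫ ω, Real.exp (s * X ω ^ 2) ∂P ≤ Real.exp (2 * (s * (K * Real.exp 1))) := by
  have hK := hX.nonneg
  have hy : 0 ≤ s * (K * Real.exp 1) := by positivity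
  have hle := (integrable_and_integral_le_of_lintegral_le
    (Real.continuous_exp.comp_aestronglyMeasurable ((hX.aestronglyMeasurable.pow 2).const_mul s))
    (fun _ => by positivity) (inv_nonneg.2 (by linarith))
    (hX.lintegral_exp_mul_sq_le hs (by linarith))).2
  calc ∫ ω, Real.exp (s * X ω ^ 2) ∂P ≤ (1 - s * (K * Real.exp 1))⁻¹ := hle
    _ ≤ 2 * (s * (K * Real.exp 1)) + 1 := by
        rw [inv_le_iff_one_le_mul₀ (by linarith)]; nlinarith
    _ ≤ Real.exp (2 * (s * (K * Real.exp 1))) := Real.add_one_le_exp _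

lemma integrable_exp_mul (hX : HasSubgaussianMoments X K P) (t : ℝ) :
    Integrable (fun ω => Real.exp (t * X ω)) P := by
  have hK := hX.nonneg
  obtain ⟨s, hs, hsK⟩ : ∃ s : ℝ, 0 < s ∧ s * (K * Real.exp 1) < 1 := by
    refine ⟨1 / (K * Real.exp 1 + 1), by positivity, ?_⟩
    rw [one_div_mul_eq_div, div_lt_one (by positivity)]
    linarith
  refine ((hX.integrable_exp_mul_sq hs.le hsK).const_mul (Real.exp (t ^ 2 / (4 * s)))).mono'
    (Real.continuous_exp.comp_aestronglyMeasurable (hX.aestronglyMeasurable.const_mul t))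
    (.of_forall fun ω => ?_)
  rw [Real.norm_of_nonneg (by positivity), ← Real.exp_add, Real.exp_le_exp]
  have hsquare : t ^ 2 / (4 * s) + s * X ω ^ 2 - t * X ω = (t - 2 * s * X ω) ^ 2 / (4 * s) := by
    field_simp; ring
  have : 0 ≤ (t - 2 * s * X ω) ^ 2 / (4 * s) := by positivity
  linarith

lemma integrable (hX : HasSubgaussianMoments X K P) : Integrable X P := by
  refine ((hX.integrable_pow 0).add (hX.integrable_pow 1)).mono' hX.aestronglyMeasurable
    (.of_forall fun ω => ?_)
  have := sq_nonneg (|X ω| - 1)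
  simp only [Pi.add_apply, mul_zero, pow_zero, mul_one, Real.norm_eq_abs]
  nlinarith [sq_abs (X ω), abs_nonneg (X ω)]

lemma mgf_le_of_sq_mul_le (hX : HasSubgaussianMoments X K P) (hmean : ∫ ω, X ω ∂P = 0) {t : ℝ}
    (ht : t ^ 2 * (K * Real.exp 1) ≤ 1 / 2) :
    mgf X P t ≤ Real.exp (2 * (t ^ 2 * (K * Real.exp 1))) := by
  have hsq := hX.integrable_exp_mul_sq (sq_nonneg t) (ht.trans_lt (by norm_num))
  calc mgf X P t ≤ ∫ ω, (t * X ω + Real.exp (t ^ 2 * X ω ^ 2)) ∂P :=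
        integral_mono (hX.integrable_exp_mul t) ((hX.integrable.const_mul t).add hsq) fun ω => by
          simpa only [mul_pow] using exp_le_add_exp_sq (t * X ω)
    _ = ∫ ω, Real.exp (t ^ 2 * X ω ^ 2) ∂P := by
        rw [integral_add (hX.integrable.const_mul t) hsq, integral_const_mul, hmean, mul_zero,
          zero_add]
    _ ≤ _ := hX.integral_exp_mul_sq_le (sq_nonneg t) ht

lemma mgf_le_of_le_sq_mul (hX : HasSubgaussianMoments X K P) {t : ℝ}
    (ht : 1 / 2 ≤ t ^ 2 * (K * Real.exp 1)) :
    mgf X P t ≤ Real.exp (5 * (K * Real.exp 1) * t ^ 2 / 2) := by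
  have hK := hX.nonneg
  set E := K * Real.exp 1 with hE
  have hE0 : 0 < E := lt_of_le_of_ne (by positivity) fun h => by rw [← h] at ht; norm_num at ht
  have hs : 1 / (2 * E) * E = 1 / 2 := by field_simp
  have hsq := hX.integrable_exp_mul_sq (s := 1 / (2 * E)) (by positivity) (by linarith)
  calc mgf X P t
      ≤ ∫ ω, Real.exp (t ^ 2 * E / 2) * Real.exp (1 / (2 * E) * X ω ^ 2) ∂P := by
        refine integral_mono (hX.integrable_exp_mul t) (hsq.const_mul _) fun ω => ?_
        simp only [← Real.exp_add, Real.exp_le_exp]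
        have hsquare : t ^ 2 * E / 2 + 1 / (2 * E) * X ω ^ 2 - t * X ω =
            (t * E - X ω) ^ 2 / (2 * E) := by
          field_simp; ring
        have : 0 ≤ (t * E - X ω) ^ 2 / (2 * E) := by positivity
        linarith
    _ ≤ Real.exp (t ^ 2 * E / 2) * Real.exp (2 * (t ^ 2 * E)) := by
        rw [integral_const_mul]
        gcongr
        refine (hX.integral_exp_mul_sq_le (by positivity) hs.le).trans ?_
        rw [Real.exp_le_exp, hs]
        linarith
    _ = Real.exp (5 * E * t ^ 2 / 2) := by
        rw [← Real.exp_add]; congr 1; ring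

lemma hasSubgaussianMGF (hX : HasSubgaussianMoments X K P) (hmean : ∫ ω, X ω ∂P = 0) :
    HasSubgaussianMGF X (5 * (K * Real.exp 1)).toNNReal P := by
  have hK := hX.nonneg
  refine ⟨hX.integrable_exp_mul, fun t => ?_⟩
  rw [Real.coe_toNNReal _ (by positivity)]
  rcases le_total (t ^ 2 * (K * Real.exp 1)) (1 / 2) with ht | ht
  · refine (hX.mgf_le_of_sq_mul_le hmean ht).trans (Real.exp_le_exp.2 ?_)
    have : 0 ≤ t ^ 2 * (K * Real.exp 1) := by positivity
    linarith
  · exact hX.mgf_le_of_le_sq_mul ht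

end HasSubgaussianMoments

lemma lintegral_exp_mul_sq_gaussianReal {a : ℝ} (ha : a < 1 / 2) :
    ∫⁻ x, ENNReal.ofReal (Real.exp (a * x ^ 2)) ∂(gaussianReal 0 1) =
      ENNReal.ofReal (√(1 - 2 * a))⁻¹ := by
  have hdensity (x : ℝ) : gaussianPDF 0 1 x * ENNReal.ofReal (Real.exp (a * x ^ 2)) =
      ENNReal.ofReal ((√(2 * Real.pi))⁻¹ * Real.exp (-(1 / 2 - a) * x ^ 2)) := by
    rw [gaussianPDF, ← ENNReal.ofReal_mul (gaussianPDFReal_nonneg _ _ _), gaussianPDFReal,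
      mul_assoc, ← Real.exp_add]
    congr 3
    · simp
    · simp only [sub_zero, NNReal.coe_one]; ring
  rw [gaussianReal_of_var_ne_zero _ one_ne_zero,
    lintegral_withDensity_eq_lintegral_mul _ (measurable_gaussianPDF _ _) (by fun_prop)]
  simp only [Pi.mul_apply, hdensity]
  rw [← ofReal_integral_eq_lintegral_ofReal
    ((integrable_exp_neg_mul_sq (by linarith)).const_mul _) (.of_forall fun x => by positivity),
    integral_const_mul, integral_gaussian, ← Real.sqrt_inv, ← Real.sqrt_inv,
    ← Real.sqrt_mul (by positivity)]
  congr 2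
  have : 1 - 2 * a ≠ 0 := by linarith
  have : 1 / 2 - a ≠ 0 := by linarith
  have := Real.pi_ne_zero
  field_simp

section SubgaussianMGF

variable {Ω ι : Type*} [MeasurableSpace Ω] {P : Measure Ω} [IsProbabilityMeasure P]

/- `exp (s x²)` is the moment generating function of a standard Gaussian variable at `√(2s) x`, so
averaging it over `X` only involves the moment generating function of `X`. -/
lemma lintegral_exp_mul_sq_le_of_hasSubgaussianMGF {X : Ω → ℝ} {c : ℝ≥0}
    (hX : HasSubgaussianMGF X c P) {s : ℝ} (hs : 0 ≤ s) (hsc : c * s < 1 / 2) :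
    ∫⁻ ω, ENNReal.ofReal (Real.exp (s * X ω ^ 2)) ∂P ≤
      ENNReal.ofReal (√(1 - 2 * (c * s)))⁻¹ := by
  have hroot : √(2 * s) ^ 2 = 2 * s := Real.sq_sqrt (by positivity)
  have hgauss (x : ℝ) : ENNReal.ofReal (Real.exp (s * x ^ 2)) =
      ∫⁻ y, ENNReal.ofReal (Real.exp (√(2 * s) * x * y)) ∂(gaussianReal 0 1) := by
    rw [← ofReal_integral_eq_lintegral_ofReal (integrable_exp_mul_gaussianReal _)
      (.of_forall fun y => by positivity)]
    have h := congrFun (mgf_fun_id_gaussianReal (μ := 0) (v := 1)) (√(2 * s) * x)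
    rw [mgf, mul_pow, hroot] at h
    rw [h]
    congr 2
    push_cast
    ring
  have hmgf (y : ℝ) : ∫⁻ ω, ENNReal.ofReal (Real.exp (√(2 * s) * X ω * y)) ∂P ≤
      ENNReal.ofReal (Real.exp (c * s * y ^ 2)) := by
    have hcomm (ω : Ω) : √(2 * s) * X ω * y = √(2 * s) * y * X ω := by ring
    simp_rw [hcomm]
    rw [← ofReal_integral_eq_lintegral_ofReal (hX.integrable_exp_mul _)
      (.of_forall fun ω => by positivity)]
    refine ENNReal.ofReal_le_ofReal ((hX.mgf_le _).trans_eq ?_)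
    rw [mul_pow, hroot]
    congr 1
    ring
  have hmeas : AEMeasurable
      (fun z : Ω × ℝ => ENNReal.ofReal (Real.exp (√(2 * s) * X z.1 * z.2)))
      (P.prod (gaussianReal 0 1)) :=
    (Real.measurable_exp.comp_aemeasurable
      ((hX.aemeasurable.comp_fst.const_mul _).mul measurable_snd.aemeasurable)).ennreal_ofReal
  calc ∫⁻ ω, ENNReal.ofReal (Real.exp (s * X ω ^ 2)) ∂P
      = ∫⁻ y, ∫⁻ ω, ENNReal.ofReal (Real.exp (√(2 * s) * X ω * y)) ∂P ∂(gaussianReal 0 1) := by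
        simp_rw [hgauss]
        exact lintegral_lintegral_swap hmeas
    _ ≤ ∫⁻ y, ENNReal.ofReal (Real.exp (c * s * y ^ 2)) ∂(gaussianReal 0 1) :=
        lintegral_mono hmgf
    _ = ENNReal.ofReal (√(1 - 2 * (c * s)))⁻¹ := lintegral_exp_mul_sq_gaussianReal hsc

lemma measureReal_sum_sq_gt_le {A : Finset ι} {X : ι → Ω → ℝ} {s δ : ℝ} (hs : 0 < s) (hδ : 0 < δ)
    (hint : ∀ a ∈ A, Integrable (fun ω => Real.exp (s * X a ω ^ 2)) P)
    (hexp : ∀ a ∈ A, ∫ ω, Real.exp (s * X a ω ^ 2) ∂P ≤ 2) :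
    P.real {ω | (A.card : ℝ) * (Real.log (2 / δ) / s) < ∑ a ∈ A, X a ω ^ 2} ≤ δ := by
  rcases A.eq_empty_or_nonempty with rfl | hA
  · simpa using hδ.le
  have hcard : (0 : ℝ) < A.card := by exact_mod_cast hA.card_pos
  have hweight : ∑ _a ∈ A, (A.card : ℝ)⁻¹ = 1 := by
    rw [Finset.sum_const, nsmul_eq_mul, mul_inv_cancel₀ hcard.ne']
  set F : Ω → ℝ := fun ω => ∑ a ∈ A, (A.card : ℝ)⁻¹ * Real.exp (s * X a ω ^ 2)
  have hF : Integrable F P := integrable_finsetSum _ fun a ha => (hint a ha).const_mul _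
  have hmean : ∫ ω, F ω ∂P ≤ 2 := by
    calc ∫ ω, F ω ∂P = ∑ a ∈ A, (A.card : ℝ)⁻¹ * ∫ ω, Real.exp (s * X a ω ^ 2) ∂P := by
          rw [integral_finsetSum _ fun a ha => (hint a ha).const_mul _]
          simp only [integral_const_mul]
      _ ≤ ∑ a ∈ A, (A.card : ℝ)⁻¹ * 2 := by gcongr with a ha; exact hexp a ha
      _ = 2 := by rw [← Finset.sum_mul, hweight, one_mul]
  have hsub : {ω | (A.card : ℝ) * (Real.log (2 / δ) / s) < ∑ a ∈ A, X a ω ^ 2} ⊆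
      {ω | 2 / δ ≤ F ω} := by
    intro ω (hω : (A.card : ℝ) * (Real.log (2 / δ) / s) < ∑ a ∈ A, X a ω ^ 2)
    have hjensen := convexOn_exp.map_sum_le (t := A) (w := fun _ => (A.card : ℝ)⁻¹)
      (p := fun a => s * X a ω ^ 2) (fun _ _ => by positivity) hweight fun _ _ => Set.mem_univ _
    refine le_trans ?_ hjensen
    rw [← Real.log_le_iff_le_exp (by positivity)]
    simp only [smul_eq_mul, ← Finset.mul_sum]
    rw [mul_div_assoc', div_lt_iff₀ hs] at hω
    rw [inv_mul_eq_div, le_div_iff₀ hcard]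
    linarith
  have hmarkov := (mul_meas_ge_le_integral_of_nonneg (μ := P) (f := F)
    (.of_forall fun ω => Finset.sum_nonneg fun a _ => by positivity) hF (2 / δ)).trans hmean
  rw [div_mul_eq_mul_div, div_le_iff₀ hδ] at hmarkov
  linarith [measureReal_mono hsub (μ := P)]

lemma measureReal_sum_sq_gt_le_of_hasSubgaussianMGF {A : Finset ι} {X : ι → Ω → ℝ} {c : ℝ≥0}
    {δ : ℝ} (hδ : 0 < δ) (hX : ∀ a ∈ A, HasSubgaussianMGF (X a) c P) :
    P.real {ω | (A.card : ℝ) * (8 / 3 * c * Real.log (2 / δ)) < ∑ a ∈ A, X a ω ^ 2} ≤ δ := by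
  rcases eq_or_ne c 0 with rfl | hc
  · have hzero : ∀ᵐ ω ∂P, ∀ a ∈ A, X a ω = 0 :=
      (Filter.eventually_all_finset A).2 fun a ha =>
        (hX a ha).ae_eq_zero_of_hasSubgaussianMGF_zero
    have hnull : P {ω | (A.card : ℝ) * (8 / 3 * (0 : ℝ≥0) * Real.log (2 / δ)) <
        ∑ a ∈ A, X a ω ^ 2} = 0 := by
      refine measure_eq_zero_iff_ae_notMem.2 (hzero.mono fun ω hω0 hω => ?_)
      have hsum : ∑ a ∈ A, X a ω ^ 2 = 0 :=
        Finset.sum_eq_zero fun a ha => by rw [hω0 a ha, zero_pow two_ne_zero]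
      simp [hsum] at hω
    rw [measureReal_def, hnull]
    exact hδ.le
  have : (0 : ℝ) < c := by positivity
  have hcs : (c : ℝ) * (3 / (8 * c)) = 3 / 8 := by field_simp
  have hexp (a : ι) (ha : a ∈ A) : Integrable (fun ω => Real.exp (3 / (8 * c) * X a ω ^ 2)) P ∧
      ∫ ω, Real.exp (3 / (8 * c) * X a ω ^ 2) ∂P ≤ 2 := by
    refine integrable_and_integral_le_of_lintegral_le
      (Real.continuous_exp.comp_aestronglyMeasurable
        (((hX a ha).aestronglyMeasurable.pow 2).const_mul _))
      (fun _ => by positivity) (by norm_num) ?_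
    refine (lintegral_exp_mul_sq_le_of_hasSubgaussianMGF (hX a ha) (by positivity)
      (by rw [hcs]; norm_num)).trans_eq ?_
    have hroot : √(1 - 2 * (3 / 8) : ℝ) = 1 / 2 := by
      rw [Real.sqrt_eq_iff_mul_self_eq] <;> norm_num
    rw [hcs, hroot, one_div, inv_inv]
  have hscale : 8 / 3 * c * Real.log (2 / δ) = Real.log (2 / δ) / (3 / (8 * c)) := by field_simp
  rw [hscale]
  exact measureReal_sum_sq_gt_le (by positivity) hδ (fun a ha => (hexp a ha).1)
    fun a ha => (hexp a ha).2

end SubgaussianMGF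

lemma hasSubgaussianMGF_weighted_sum {Ω ι : Type*} [MeasurableSpace Ω] {P : Measure Ω}
    [Fintype ι] {X : ι → Ω → ℝ} {c : ℝ≥0} (hindep : iIndepFun X P)
    (hX : ∀ i, HasSubgaussianMGF (X i) c P) {a : ι → ℝ} (ha : ∑ i, a i ^ 2 = 1) :
    HasSubgaussianMGF (fun ω => ∑ i, a i * X i ω) c P := by
  have hparam : ∑ i, NNReal.mk (a i ^ 2) (sq_nonneg _) * c = c := by
    ext
    push_cast
    rw [← Finset.sum_mul]
    exact (congrArg (· * (c : ℝ)) ha).trans (one_mul _)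
  rw [← hparam]
  exact HasSubgaussianMGF.sum_of_iIndepFun
    (hindep.comp (fun i x => a i * x) fun i => measurable_const_mul (a i))
    fun i _ => (hX i).const_mul (a i)

section Psi2Norm

variable {Ω : Type*} [MeasurableSpace Ω] {P : Measure Ω} [IsProbabilityMeasure P] {X : Ω → ℝ}

lemma rpow_mul_integral_rpow_le_psi2Norm {C : ℝ} (hX : ∀ᵐ ω ∂P, |X ω| ≤ C) {q : ℝ} (hq : 1 ≤ q) :
    q ^ (-(1 / 2) : ℝ) * (∫ ω, |X ω| ^ q ∂P) ^ (1 / q) ≤ psi2Norm P X := by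
  obtain ⟨ω₀, hω₀⟩ := hX.exists
  have hC : 0 ≤ C := (abs_nonneg _).trans hω₀
  refine le_ciSup (f := fun q : Set.Ici (1 : ℝ) => (q : ℝ) ^ (-(1 / 2) : ℝ) *
    (∫ ω, |X ω| ^ (q : ℝ) ∂P) ^ (1 / (q : ℝ))) ⟨C, ?_⟩ ⟨q, hq⟩
  rintro _ ⟨⟨r, hr : 1 ≤ r⟩, rfl⟩
  have hr0 : 0 < r := one_pos.trans_le hr
  have hint : 0 ≤ ∫ ω, |X ω| ^ r ∂P := integral_nonneg fun ω => by positivity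
  have hintC : ∫ ω, |X ω| ^ r ∂P ≤ C ^ r := by
    have h := norm_integral_le_of_norm_le_const (μ := P) (f := fun ω => |X ω| ^ r) (C := C ^ r)
      (hX.mono fun ω hω => by
        rw [Real.norm_of_nonneg (by positivity)]
        exact Real.rpow_le_rpow (abs_nonneg _) hω hr0.le)
    rwa [probReal_univ, mul_one, Real.norm_of_nonneg hint] at h
  calc r ^ (-(1 / 2) : ℝ) * (∫ ω, |X ω| ^ r ∂P) ^ (1 / r)
      ≤ 1 * (C ^ r) ^ (1 / r) := by
        gcongr
        exact Real.rpow_le_one_of_one_le_of_nonpos hr (by norm_num)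
    _ = C := by rw [one_mul, one_div, Real.rpow_rpow_inv hC hr0.ne']

lemma integral_pow_le_psi2Norm {C : ℝ} (hX : ∀ᵐ ω ∂P, |X ω| ≤ C) (m : ℕ) :
    ∫ ω, X ω ^ (2 * m) ∂P ≤ (2 * psi2Norm P X ^ 2 * m) ^ m := by
  rcases Nat.eq_zero_or_pos m with rfl | hm
  · simp
  have hq0 : (0 : ℝ) < (2 * m : ℕ) := by positivity
  have hq1 : (1 : ℝ) ≤ (2 * m : ℕ) := by exact_mod_cast (by lia : 1 ≤ 2 * m)
  have hroot := rpow_mul_integral_rpow_le_psi2Norm hX hq1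
  simp only [Real.rpow_natCast, (even_two_mul m).pow_abs] at hroot
  have hint : 0 ≤ ∫ ω, X ω ^ (2 * m) ∂P :=
    integral_nonneg fun ω => (even_two_mul m).pow_nonneg _
  rw [Real.rpow_neg hq0.le, inv_mul_le_iff₀ (by positivity), ← Real.sqrt_eq_rpow] at hroot
  calc ∫ ω, X ω ^ (2 * m) ∂P
      = ((∫ ω, X ω ^ (2 * m) ∂P) ^ (1 / ((2 * m : ℕ) : ℝ))) ^ (2 * m) := by
        rw [one_div, Real.rpow_inv_natCast_pow hint (by lia)]
    _ ≤ (√(2 * m : ℕ) * psi2Norm P X) ^ (2 * m) := by gcongr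
    _ = (2 * psi2Norm P X ^ 2 * m) ^ m := by
        rw [pow_mul, mul_pow, Real.sq_sqrt hq0.le]
        push_cast
        ring

lemma hasSubgaussianMoments_psi2Norm {C : ℝ} (hmeas : AEStronglyMeasurable X P)
    (hX : ∀ᵐ ω ∂P, |X ω| ≤ C) : HasSubgaussianMoments X (2 * psi2Norm P X ^ 2) P where
  aestronglyMeasurable := hmeas
  integrable_pow m := Integrable.of_bound (hmeas.pow _) (C ^ (2 * m)) (hX.mono fun ω hω => by
    rw [norm_pow, Real.norm_eq_abs]
    gcongr)
  integral_pow_le := integral_pow_le_psi2Norm hX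

end Psi2Norm

/-! ### Coefficients in an orthonormal basis -/

section Coef

variable {T : ℕ} {E F : Type*} [AddCommGroup E] [Module ℝ E] [AddCommGroup F] [Module ℝ F]

/-- The coefficients of a sequence `z(1), …, z(T)` of vectors in the orthonormal basis `v` of `ℝ^T`,
the transform being applied to the time index. -/
noncomputable def coef (v : OrthonormalBasis (Fin T) ℝ (EuclideanSpace ℝ (Fin T)))
    (z : Fin T → E) (l : Fin T) : E :=
  ∑ k, v l k • z k

variable (v : OrthonormalBasis (Fin T) ℝ (EuclideanSpace ℝ (Fin T)))

lemma map_coef (ψ : E →ₗ[ℝ] F) (z : Fin T → E) (l : Fin T) :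
    ψ (coef v z l) = coef v (fun k => ψ (z k)) l := by
  simp only [coef, map_sum, map_smul]

lemma coef_sub (z w : Fin T → E) (l : Fin T) :
    coef v (fun k => z k - w k) l = coef v z l - coef v w l := by
  simp only [coef, smul_sub, Finset.sum_sub_distrib]

lemma coef_sum_smul {ι : Type*} (A : Finset ι) (a : ι → Fin T → ℝ) (z : ι → E) (l : Fin T) :
    coef v (fun k => ∑ i ∈ A, a i k • z i) l = ∑ i ∈ A, coef v (a i) l • z i := by
  simp only [coef, Finset.smul_sum, Finset.sum_smul, smul_smul, smul_eq_mul]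
  exact Finset.sum_comm

lemma coef_eq_inner (x : Fin T → ℝ) (l : Fin T) : coef v x l = inner ℝ (v l) (WithLp.toLp 2 x) := by
  simp only [coef, PiLp.inner_apply, smul_eq_mul, RCLike.inner_apply, conj_trivial, mul_comm]

lemma coef_basis (l m : Fin T) : coef v (v m).ofLp l = if l = m then 1 else 0 := by
  rw [coef_eq_inner]
  exact orthonormal_iff_ite.1 v.orthonormal l m

lemma sum_sq_basis (l : Fin T) : ∑ k, v l k ^ 2 = 1 := by
  simpa only [coef, smul_eq_mul, ← sq, if_true] using coef_basis v l l

lemma sum_sq_eq_sum_coef_sq (x : Fin T → ℝ) : ∑ k, x k ^ 2 = ∑ l, coef v x l ^ 2 := by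
  have h := v.sum_sq_norm_inner_right (WithLp.toLp 2 x)
  simpa only [EuclideanSpace.norm_sq_eq, Real.norm_eq_abs, sq_abs, ← coef_eq_inner] using h.symm

lemma eq_sum_coef_smul (x : Fin T → ℝ) : x = ∑ l, coef v x l • (v l).ofLp := by
  have h := congrArg WithLp.ofLp (v.sum_repr' (WithLp.toLp 2 x))
  simpa only [← coef_eq_inner, WithLp.ofLp_sum, WithLp.ofLp_smul] using h.symm

end Coef

/-! ### The spectrum of the path Laplacian -/

section Eigenbasis

variable {T : ℕ} {M : Matrix (Fin T) (Fin T) ℝ} {lam : Fin T → ℝ}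
  {v : OrthonormalBasis (Fin T) ℝ (EuclideanSpace ℝ (Fin T))}

lemma dotProduct_mulVec_eq_sum_eigenvalue_mul (hM : ∀ l, M.mulVec (v l).ofLp = lam l • (v l).ofLp)
    (x : Fin T → ℝ) : x ⬝ᵥ M.mulVec x = ∑ l, lam l * coef v x l ^ 2 := by
  have hMx : M.mulVec x = ∑ l, (coef v x l * lam l) • (v l).ofLp := by
    conv_lhs => rw [eq_sum_coef_smul v x, Matrix.mulVec_sum]
    simp only [Matrix.mulVec_smul, hM, smul_smul]
  rw [hMx, dotProduct_sum]
  refine Finset.sum_congr rfl fun l _ => ?_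
  have hcoef : x ⬝ᵥ (v l).ofLp = coef v x l := dotProduct_comm _ _
  rw [dotProduct_smul, hcoef, smul_eq_mul]
  ring

/- The lower half of the Courant–Fischer principle: some nonzero `x ∈ ker Φ` is orthogonal to all
`v m` with `m < l`, and the quadratic form of `M` at such an `x` is at most `lam l * ∑ x k ^ 2`. -/
lemma le_eigenvalue_of_forall_mem_ker {W : Type*} [AddCommGroup W] [Module ℝ W]
    [FiniteDimensional ℝ W] (hlam : Antitone lam)
    (hM : ∀ l, M.mulVec (v l).ofLp = lam l • (v l).ofLp) (Φ : (Fin T → ℝ) →ₗ[ℝ] W) {l : Fin T}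
    (hl : (l : ℕ) + Module.finrank ℝ W < T) {c : ℝ}
    (hc : ∀ x ∈ LinearMap.ker Φ, c * ∑ k, x k ^ 2 ≤ x ⬝ᵥ M.mulVec x) : c ≤ lam l := by
  let Ψ : (Fin T → ℝ) →ₗ[ℝ] (Fin l → ℝ) × W :=
    (LinearMap.pi fun m => ∑ k, v (m.castLE l.is_lt.le) k • LinearMap.proj k).prod Φ
  have hker : LinearMap.ker Ψ ≠ ⊥ := LinearMap.ker_ne_bot_of_finrank_lt (by
    rwa [Module.finrank_prod, Module.finrank_fin_fun, Module.finrank_fin_fun])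
  obtain ⟨x, hxker, hx0⟩ := (Submodule.ne_bot_iff _).1 hker
  have hxΦ : x ∈ LinearMap.ker Φ := congrArg Prod.snd (LinearMap.mem_ker.1 hxker)
  have hlow (m : Fin T) (hm : m < l) : coef v x m = 0 := by
    simpa [Ψ, coef] using congrFun (congrArg Prod.fst (LinearMap.mem_ker.1 hxker)) ⟨m, hm⟩
  have hpos : 0 < ∑ k, x k ^ 2 := by
    obtain ⟨k, hk⟩ := Function.ne_iff.1 hx0
    exact Finset.sum_pos' (fun _ _ => sq_nonneg _) ⟨k, Finset.mem_univ _, sq_pos_of_ne_zero hk⟩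
  refine le_of_mul_le_mul_right ((hc x hxΦ).trans ?_) hpos
  rw [dotProduct_mulVec_eq_sum_eigenvalue_mul hM, sum_sq_eq_sum_coef_sq v, Finset.mul_sum]
  refine Finset.sum_le_sum fun m _ => ?_
  rcases lt_or_ge m l with hm | hm
  · simp [hlow m hm]
  · exact mul_le_mul_of_nonneg_right (hlam hm) (sq_nonneg _)

end Eigenbasis

section BlockPoincare

variable {L N : ℕ}

lemma card_filter_div_eq_le (hL : 0 < L) (b : ℕ) :
    ((Finset.range N).filter fun i => i / L = b).card ≤ L := by
  have hsub : (Finset.range N).filter (fun i => i / L = b) ⊆ Finset.Ico (b * L) (b * L + L) := by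
    intro i hi
    obtain ⟨-, rfl⟩ := Finset.mem_filter.1 hi
    exact Finset.mem_Ico.2 ⟨Nat.div_mul_le_self i L, Nat.lt_div_mul_add hL⟩
  simpa using Finset.card_le_card hsub

lemma sq_sub_le_of_div_eq (hL : 0 < L) (y : ℕ → ℝ) {i j : ℕ} (hij : i ≤ j) (hj : j < N)
    (hdiv : i / L = j / L) :
    (y i - y j) ^ 2 ≤
      L * ∑ k ∈ (Finset.range (N - 1)).filter (fun k => k / L = i / L), (y k - y (k + 1)) ^ 2 := by
  have htelescope : y i - y j = ∑ k ∈ Finset.Ico i j, (y k - y (k + 1)) := by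
    rw [← neg_inj, ← Finset.sum_neg_distrib, neg_sub, ← Finset.sum_Ico_sub y hij]
    simp only [neg_sub]
  have hsub : Finset.Ico i j ⊆ (Finset.range (N - 1)).filter (fun k => k / L = i / L) := by
    intro k hk
    obtain ⟨hik, hkj⟩ := Finset.mem_Ico.1 hk
    refine Finset.mem_filter.2 ⟨Finset.mem_range.2 (by lia), ?_⟩
    exact le_antisymm (hdiv ▸ Nat.div_le_div_right hkj.le) (Nat.div_le_div_right hik)
  have hcard : (Finset.Ico i j).card ≤ L :=
    (Finset.card_le_card hsub).trans (card_filter_div_eq_le hL _)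
  calc (y i - y j) ^ 2
      ≤ (Finset.Ico i j).card * ∑ k ∈ Finset.Ico i j, (y k - y (k + 1)) ^ 2 := by
        rw [htelescope]
        exact sq_sum_le_card_mul_sum_sq
    _ ≤ _ := by gcongr

/- In a block with zero sum, every entry faces an entry of the opposite sign, hence is bounded by
the variation inside the block. -/
lemma sq_le_of_block_sum_eq_zero (hL : 0 < L) (y : ℕ → ℝ) {i : ℕ} (hi : i < N)
    (hy : ∑ j ∈ (Finset.range N).filter (fun j => j / L = i / L), y j = 0) :
    y i ^ 2 ≤
      L * ∑ k ∈ (Finset.range (N - 1)).filter (fun k => k / L = i / L), (y k - y (k + 1)) ^ 2 := by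
  obtain ⟨j, hj, hopposite⟩ : ∃ j ∈ (Finset.range N).filter (fun j => j / L = i / L),
      y i * y j ≤ 0 := by
    refine Finset.exists_le_of_sum_le ⟨i, Finset.mem_filter.2 ⟨Finset.mem_range.2 hi, rfl⟩⟩ ?_
    rw [← Finset.mul_sum, hy, mul_zero, Finset.sum_const_zero]
  obtain ⟨hjN, hdiv⟩ := Finset.mem_filter.1 hj
  rw [Finset.mem_range] at hjN
  have hsq : y i ^ 2 ≤ (y i - y j) ^ 2 := by nlinarith [sq_nonneg (y j)]
  refine hsq.trans ?_
  rcases le_total i j with hij | hji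
  · exact sq_sub_le_of_div_eq hL y hij hjN hdiv.symm
  · rw [← hdiv, ← neg_sub, neg_sq]
    exact sq_sub_le_of_div_eq hL y hji hi hdiv

lemma sum_range_sq_le_of_block_sum_eq_zero (hL : 0 < L) (y : ℕ → ℝ)
    (hy : ∀ b, ∑ i ∈ (Finset.range N).filter (fun i => i / L = b), y i = 0) :
    ∑ i ∈ Finset.range N, y i ^ 2 ≤
      (L : ℝ) ^ 2 * ∑ k ∈ Finset.range (N - 1), (y k - y (k + 1)) ^ 2 := by
  calc ∑ i ∈ Finset.range N, y i ^ 2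
      ≤ ∑ i ∈ Finset.range N, L *
          ∑ k ∈ (Finset.range (N - 1)).filter (fun k => k / L = i / L), (y k - y (k + 1)) ^ 2 :=
        Finset.sum_le_sum fun i hi =>
          sq_le_of_block_sum_eq_zero hL y (Finset.mem_range.1 hi) (hy _)
    _ = L * ∑ k ∈ Finset.range (N - 1),
          ((Finset.range N).filter fun i => i / L = k / L).card * (y k - y (k + 1)) ^ 2 := by
        rw [← Finset.mul_sum]
        simp only [Finset.sum_filter]
        rw [Finset.sum_comm]
        simp only [← Finset.sum_filter, Finset.sum_const, nsmul_eq_mul, eq_comm]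
    _ ≤ L * ∑ k ∈ Finset.range (N - 1), L * (y k - y (k + 1)) ^ 2 := by
        gcongr
        exact card_filter_div_eq_le hL _
    _ = _ := by rw [← Finset.mul_sum, sq, mul_assoc]

end BlockPoincare

section PathEnergy

variable {T : ℕ}

/-- The Dirichlet energy `∑_{k=1}^{T-1} ‖x(k) - x(k+1)‖²` of a sequence of vectors. -/
noncomputable def pathEnergy {E : Type*} [NormedAddCommGroup E] (x : Fin T → E) : ℝ :=
  ∑ k : Fin (T - 1), ‖x ⟨k, by omega⟩ - x ⟨k + 1, by omega⟩‖ ^ 2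

lemma pathEnergy_nonneg {E : Type*} [NormedAddCommGroup E] (x : Fin T → E) : 0 ≤ pathEnergy x :=
  Finset.sum_nonneg fun _ _ => by positivity

lemma sum_sq_le_pathEnergy_of_block_sum_eq_zero {L : ℕ} (hL : 0 < L) (x : Fin T → ℝ)
    (hx : ∀ b, ∑ i ∈ Finset.univ.filter (fun i : Fin T => (i : ℕ) / L = b), x i = 0) :
    ∑ i, x i ^ 2 ≤ (L : ℝ) ^ 2 * pathEnergy x := by
  obtain ⟨y, hyx⟩ : ∃ y : ℕ → ℝ, ∀ (i : ℕ) (hi : i < T), y i = x ⟨i, hi⟩ :=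
    ⟨fun i => if h : i < T then x ⟨i, h⟩ else 0, fun i hi => dif_pos hi⟩
  have hy (b : ℕ) : ∑ i ∈ (Finset.range T).filter (fun i => i / L = b), y i = 0 := by
    rw [← hx b, Finset.sum_filter, Finset.sum_filter, Finset.sum_range]
    simp only [hyx, Fin.is_lt]
  have h := sum_range_sq_le_of_block_sum_eq_zero hL y hy
  rw [Finset.sum_range, Finset.sum_range] at h
  have hlt (k : Fin (T - 1)) : (k : ℕ) + 1 < T := Nat.add_lt_of_lt_sub k.is_lt
  simpa only [pathEnergy, Real.norm_eq_abs, sq_abs, hyx, Fin.is_lt, hlt,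
    (Nat.lt_succ_self _).trans (hlt _)] using h

lemma sum_sum_succ_eq_pathEnergy (x : Fin T → ℝ) :
    ∑ i : Fin T, ∑ j : Fin T, (if (i : ℕ) + 1 = j then (x i - x j) ^ 2 else 0) = pathEnergy x := by
  cases T with
  | zero => simp [pathEnergy]
  | succ N =>
    have hlast (j : Fin (N + 1)) : ¬ ((Fin.last N : Fin (N + 1)) : ℕ) + 1 = j := by
      rw [Fin.val_last]; lia
    rw [Fin.sum_univ_castSucc]
    simp only [hlast, if_false, Finset.sum_const_zero, add_zero]
    refine Finset.sum_congr rfl fun i _ => ?_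
    rw [Finset.sum_eq_single i.succ]
    · rw [if_pos (by simp), Real.norm_eq_abs, sq_abs]
      rfl
    · intro j _ hj
      exact if_neg fun hij => hj (Fin.ext (by simpa using hij.symm))
    · simp

lemma dotProduct_pathLaplacian_mulVec (x : Fin T → ℝ) :
    x ⬝ᵥ (pathLaplacian T).mulVec x = pathEnergy x := by
  unfold pathLaplacian
  let := Classical.decRel (SimpleGraph.pathGraph T).Adj
  have h := (SimpleGraph.pathGraph T).lapMatrix_toLinearMap₂' ℝ x
  rw [Matrix.toLinearMap₂'_apply'] at h
  have hswap : ∑ i : Fin T, ∑ j : Fin T, (if (j : ℕ) + 1 = i then (x i - x j) ^ 2 else 0) =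
      pathEnergy x := by
    rw [Finset.sum_comm, ← sum_sum_succ_eq_pathEnergy]
    refine Finset.sum_congr rfl fun i _ => Finset.sum_congr rfl fun j _ => ?_
    rw [← neg_sub, neg_sq]
  have hsplit (i j : Fin T) :
      (if (SimpleGraph.pathGraph T).Adj i j then (x i - x j) ^ 2 else 0) =
        (if (i : ℕ) + 1 = j then (x i - x j) ^ 2 else 0) +
        (if (j : ℕ) + 1 = i then (x i - x j) ^ 2 else 0) := by
    simp only [SimpleGraph.pathGraph_adj]
    split_ifs <;> first | lia | simp
  simp only [hsplit, Finset.sum_add_distrib, sum_sum_succ_eq_pathEnergy, hswap] at h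
  linarith

end PathEnergy

namespace IsSortedEigenbasis

variable {T : ℕ} {lam : Fin T → ℝ} {v : OrthonormalBasis (Fin T) ℝ (EuclideanSpace ℝ (Fin T))}

lemma pathEnergy_real (hv : IsSortedEigenbasis lam v) (x : Fin T → ℝ) :
    pathEnergy x = ∑ l, lam l * coef v x l ^ 2 := by
  rw [← dotProduct_pathLaplacian_mulVec, dotProduct_mulVec_eq_sum_eigenvalue_mul hv.eigen]

lemma eigenvalue_nonneg (hv : IsSortedEigenbasis lam v) (l : Fin T) : 0 ≤ lam l := by
  have h := hv.pathEnergy_real (v l).ofLp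
  simp only [coef_basis, ite_pow, one_pow, zero_pow two_ne_zero, mul_ite, mul_one, mul_zero,
    Finset.sum_ite_eq', Finset.mem_univ, if_true] at h
  exact h ▸ pathEnergy_nonneg _

/- The `τ` sums over blocks of length `L = ⌈T / τ⌉ ≤ 2 T / τ` are the linear constraints under which
the Poincaré inequality holds. -/
lemma le_eigenvalue (hv : IsSortedEigenbasis lam v) {τ : ℕ} (hτ : 0 < τ) {l : Fin T}
    (hl : (l : ℕ) + τ < T) : (τ : ℝ) ^ 2 / (4 * (T : ℝ) ^ 2) ≤ lam l := by
  obtain ⟨L, hL, hTL, hLT⟩ : ∃ L : ℕ, 0 < L ∧ T ≤ L * τ ∧ L * τ ≤ 2 * T := by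
    have hlow := Nat.lt_mul_div_succ (T - 1) hτ
    have hhigh := Nat.mul_div_le (T - 1) τ
    exact ⟨(T - 1) / τ + 1, Nat.succ_pos _, by lia, by lia⟩
  let Φ : (Fin T → ℝ) →ₗ[ℝ] (Fin τ → ℝ) :=
    LinearMap.pi fun b =>
      ∑ i ∈ Finset.univ.filter fun i : Fin T => (i : ℕ) / L = b, LinearMap.proj i
  have hpoincare (x : Fin T → ℝ) (hx : x ∈ LinearMap.ker Φ) :
      ((L : ℝ) ^ 2)⁻¹ * ∑ k, x k ^ 2 ≤ x ⬝ᵥ (pathLaplacian T).mulVec x := by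
    rw [dotProduct_pathLaplacian_mulVec, inv_mul_le_iff₀ (by positivity)]
    refine sum_sq_le_pathEnergy_of_block_sum_eq_zero hL x fun b => ?_
    rcases lt_or_ge b τ with hb | hb
    · simpa [Φ] using congrFun (LinearMap.mem_ker.1 hx) ⟨b, hb⟩
    · refine Finset.sum_eq_zero fun i hi => absurd (Finset.mem_filter.1 hi).2 (ne_of_lt ?_)
      exact (Nat.div_lt_of_lt_mul (i.is_lt.trans_le hTL)).trans_le hb
  refine le_trans ?_ (le_eigenvalue_of_forall_mem_ker hv.antitone hv.eigen Φ (by simpa using hl)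
    hpoincare)
  have hLT' : (L : ℝ) * τ ≤ 2 * T := by exact_mod_cast hLT
  have hT : (0 : ℝ) < T := by exact_mod_cast (Nat.zero_le _).trans_lt hl
  rw [← one_div, div_le_div_iff₀ (by positivity) (by positivity)]
  calc (τ : ℝ) ^ 2 * (L : ℝ) ^ 2 = (L * τ) ^ 2 := by ring
    _ ≤ (2 * (T : ℝ)) ^ 2 := by gcongr
    _ = 1 * (4 * (T : ℝ) ^ 2) := by ring

end IsSortedEigenbasis

/-! ### Projections onto low frequencies -/

lemma sq_norm_eq_re_sq_add_im_sq (z : ℂ) : ‖z‖ ^ 2 = z.re ^ 2 + z.im ^ 2 := by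
  rw [Complex.sq_norm, Complex.normSq_apply, sq, sq]

section LowFrequencies

variable {n T : ℕ} (v : OrthonormalBasis (Fin T) ℝ (EuclideanSpace ℝ (Fin T)))

lemma re_coef (z : Fin T → ℂ) (l : Fin T) : (coef v z l).re = coef v (fun k => (z k).re) l :=
  map_coef v Complex.reLm z l

lemma im_coef (z : Fin T → ℂ) (l : Fin T) : (coef v z l).im = coef v (fun k => (z k).im) l :=
  map_coef v Complex.imLm z l

lemma sum_sq_norm_eq_sum_sq_norm_coef (z : Fin T → ℂ) :
    ∑ k, ‖z k‖ ^ 2 = ∑ l, ‖coef v z l‖ ^ 2 := by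
  simp only [sq_norm_eq_re_sq_add_im_sq, re_coef, im_coef, Finset.sum_add_distrib]
  rw [sum_sq_eq_sum_coef_sq v, sum_sq_eq_sum_coef_sq v fun k => (z k).im]

lemma frobSq_eq_sum_coef (X : Matrix (Fin T × Fin n) (Fin n) ℂ) :
    frobSq X = ∑ i, ∑ j, ∑ l, ‖coef v (fun k => X (k, i) j) l‖ ^ 2 := by
  simp only [← sum_sq_norm_eq_sum_sq_norm_coef, frobSq, Fintype.sum_prod_type]
  rw [Finset.sum_comm]
  exact Finset.sum_congr rfl fun i _ => Finset.sum_comm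

/-- The indices of the `τ` smallest eigenvalues. -/
def lowIdx (T τ : ℕ) : Finset (Fin T) := Finset.univ.filter fun k : Fin T => T ≤ (k : ℕ) + τ

lemma mem_lowIdx {τ : ℕ} {k : Fin T} : k ∈ lowIdx T τ ↔ T ≤ (k : ℕ) + τ := by
  rw [lowIdx, Finset.mem_filter_univ]

lemma card_lowIdx_le (T τ : ℕ) : (lowIdx T τ).card ≤ τ := by
  have hsub : (lowIdx T τ).map Fin.valEmbedding ⊆ Finset.Ico (T - τ) T := by
    intro i hi
    obtain ⟨k, hk, rfl⟩ := Finset.mem_map.1 hi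
    exact Finset.mem_Ico.2 ⟨Nat.sub_le_iff_le_add.2 (mem_lowIdx.1 hk), k.is_lt⟩
  have hcard := Finset.card_le_card hsub
  rw [Finset.card_map, Nat.card_Ico] at hcard
  lia

lemma proj_mul_apply (τ : ℕ) (X : Matrix (Fin T × Fin n) (Fin n) ℂ) (k : Fin T) (i j : Fin n) :
    (proj v τ n * X) (k, i) j = ∑ l ∈ lowIdx T τ, v l k • coef v (fun k => X (k, i) j) l := by
  have hcol (k' : Fin T) : ∑ i', proj v τ n (k, i) (k', i') * X (k', i') j =
      ∑ l ∈ lowIdx T τ, v l k • (v l k' • X (k', i) j) := by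
    rw [Finset.sum_eq_single i]
    · simp [proj, lowFreq, Matrix.sum_apply, Matrix.vecMulVec_apply, lowIdx, Finset.sum_mul,
        mul_assoc]
    · intro i' _ hi'
      simp [proj, Matrix.one_apply_ne' hi']
    · simp
  rw [Matrix.mul_apply, Fintype.sum_prod_type]
  simp only [hcol, coef, Finset.smul_sum]
  exact Finset.sum_comm

lemma coef_proj_mul (τ : ℕ) (X : Matrix (Fin T × Fin n) (Fin n) ℂ) (i j : Fin n) (m : Fin T) :
    coef v (fun k => (proj v τ n * X) (k, i) j) m =
      if m ∈ lowIdx T τ then coef v (fun k => X (k, i) j) m else 0 := by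
  simp only [proj_mul_apply, coef_sum_smul, coef_basis, ite_smul, one_smul, zero_smul,
    Finset.sum_ite_eq]

lemma frobSq_one_sub_proj_mul (τ : ℕ) (Y : Matrix (Fin T × Fin n) (Fin n) ℂ) :
    frobSq ((1 - proj v τ n) * Y) =
      ∑ i, ∑ j, ∑ l ∈ (lowIdx T τ)ᶜ, ‖coef v (fun k => Y (k, i) j) l‖ ^ 2 := by
  rw [frobSq_eq_sum_coef v, Matrix.sub_mul, Matrix.one_mul]
  refine Finset.sum_congr rfl fun i _ => Finset.sum_congr rfl fun j _ => ?_
  simp only [Matrix.sub_apply, coef_sub, coef_proj_mul]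
  rw [← Finset.sum_ite_mem_eq (lowIdx T τ)ᶜ]
  refine Finset.sum_congr rfl fun l _ => ?_
  by_cases hl : l ∈ lowIdx T τ <;> simp [hl]

lemma frobSq_proj_mul_sub (τ : ℕ) (X Y : Matrix (Fin T × Fin n) (Fin n) ℂ) :
    frobSq (proj v τ n * X - Y) =
      (∑ i, ∑ j, ∑ l ∈ lowIdx T τ, ‖coef v (fun k => (X - Y) (k, i) j) l‖ ^ 2) +
        frobSq ((1 - proj v τ n) * Y) := by
  rw [frobSq_one_sub_proj_mul, frobSq_eq_sum_coef v]
  simp only [← Finset.sum_add_distrib, Matrix.sub_apply, coef_sub, coef_proj_mul]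
  refine Finset.sum_congr rfl fun i _ => Finset.sum_congr rfl fun j _ => ?_
  rw [← Finset.sum_add_sum_compl (lowIdx T τ)]
  congr 1 <;> refine Finset.sum_congr rfl fun l hl => ?_
  · rw [if_pos hl]
  · rw [if_neg (Finset.mem_compl.1 hl), zero_sub, norm_neg]

end LowFrequencies

/-! ### The bias -/

section Bias

variable {n T : ℕ} {lam : Fin T → ℝ}
  {v : OrthonormalBasis (Fin T) ℝ (EuclideanSpace ℝ (Fin T))}

namespace IsSortedEigenbasis

lemma pathEnergy_complex (hv : IsSortedEigenbasis lam v) (z : Fin T → ℂ) :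
    pathEnergy z = ∑ l, lam l * ‖coef v z l‖ ^ 2 := by
  have hsplit : pathEnergy z = pathEnergy (fun k => (z k).re) + pathEnergy fun k => (z k).im := by
    simp only [pathEnergy, sq_norm_eq_re_sq_add_im_sq, Complex.sub_re, Complex.sub_im,
      Real.norm_eq_abs, sq_abs, Finset.sum_add_distrib]
  simp only [hsplit, hv.pathEnergy_real, sq_norm_eq_re_sq_add_im_sq, re_coef, im_coef, mul_add,
    Finset.sum_add_distrib]

lemma sum_high_sq_norm_coef_le (hv : IsSortedEigenbasis lam v) {τ : ℕ} (hτ : 0 < τ)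
    (z : Fin T → ℂ) :
    ∑ l ∈ (lowIdx T τ)ᶜ, ‖coef v z l‖ ^ 2 ≤ 4 * (T : ℝ) ^ 2 / (τ : ℝ) ^ 2 * pathEnergy z := by
  calc ∑ l ∈ (lowIdx T τ)ᶜ, ‖coef v z l‖ ^ 2
      ≤ ∑ l ∈ (lowIdx T τ)ᶜ, 4 * (T : ℝ) ^ 2 / (τ : ℝ) ^ 2 * (lam l * ‖coef v z l‖ ^ 2) := by
        refine Finset.sum_le_sum fun l hl => ?_
        rw [Finset.mem_compl, mem_lowIdx, not_le] at hl
        have hT : (0 : ℝ) < T := by exact_mod_cast (Nat.zero_le _).trans_lt hl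
        have hlam : 1 ≤ 4 * (T : ℝ) ^ 2 / (τ : ℝ) ^ 2 * lam l := by
          rw [← inv_div, inv_mul_eq_div, one_le_div (by positivity)]
          exact hv.le_eigenvalue hτ hl
        rw [← mul_assoc]
        exact le_mul_of_one_le_left (sq_nonneg _) hlam
    _ ≤ ∑ l, 4 * (T : ℝ) ^ 2 / (τ : ℝ) ^ 2 * (lam l * ‖coef v z l‖ ^ 2) :=
        Finset.sum_le_univ_sum_of_nonneg fun l => by
          have := hv.eigenvalue_nonneg l
          positivity
    _ = _ := by rw [← Finset.mul_sum, hv.pathEnergy_complex]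

lemma frobSq_one_sub_proj_mul_le (hv : IsSortedEigenbasis lam v) {τ : ℕ} (hτ : 0 < τ)
    (Y : Matrix (Fin T × Fin n) (Fin n) ℂ) :
    frobSq ((1 - proj v τ n) * Y) ≤
      4 * (T : ℝ) ^ 2 / (τ : ℝ) ^ 2 * ∑ i, ∑ j, pathEnergy fun k => Y (k, i) j := by
  simp only [frobSq_one_sub_proj_mul, Finset.mul_sum]
  exact Finset.sum_le_sum fun i _ => Finset.sum_le_sum fun j _ => hv.sum_high_sq_norm_coef_le hτ _

end IsSortedEigenbasis

lemma sq_norm_mul_star_sub_le {a b a' b' : ℂ} (hb : ‖b‖ ≤ 1) (ha' : ‖a'‖ ≤ 1) :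
    ‖a * star b - a' * star b'‖ ^ 2 ≤ 2 * ‖a - a'‖ ^ 2 + 2 * ‖b - b'‖ ^ 2 := by
  have hsplit : a * star b - a' * star b' = (a - a') * star b + a' * star (b - b') := by
    rw [star_sub]
    ring
  calc ‖a * star b - a' * star b'‖ ^ 2
      ≤ (‖(a - a') * star b‖ + ‖a' * star (b - b')‖) ^ 2 := by
        rw [hsplit]
        gcongr
        exact norm_add_le _ _
    _ ≤ (‖a - a'‖ + ‖b - b'‖) ^ 2 := by
        rw [norm_mul, norm_mul, norm_star, norm_star]
        gcongr
        · exact mul_le_of_le_one_right (norm_nonneg _) hb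
        · exact mul_le_of_le_one_left (norm_nonneg _) ha'
    _ ≤ 2 * ‖a - a'‖ ^ 2 + 2 * ‖b - b'‖ ^ 2 := by
        linarith [add_sq_le (a := ‖a - a'‖) (b := ‖b - b'‖)]

variable {g : Fin T → Fin n → ℂ}

lemma Gbar_apply (k : Fin T) (i j : Fin n) :
    Gbar g (k, i) j = g k i * star (g k j) - (1 : Matrix (Fin n) (Fin n) ℂ) i j := rfl

lemma pathEnergy_Gbar_le (hg : ∀ k i, ‖g k i‖ ≤ 1) (i j : Fin n) :
    pathEnergy (fun k => Gbar g (k, i) j) ≤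
      2 * pathEnergy (fun k => g k i) + 2 * pathEnergy fun k => g k j := by
  simp only [pathEnergy, Finset.mul_sum, ← Finset.sum_add_distrib, Gbar_apply,
    sub_sub_sub_cancel_right]
  exact Finset.sum_le_sum fun k _ => sq_norm_mul_star_sub_le (hg _ _) (hg _ _)

lemma sum_pathEnergy_Gbar_le {S : ℝ} (hg : ∀ k i, ‖g k i‖ ≤ 1) (hS : SignalSmooth g S) :
    ∑ i, ∑ j, pathEnergy (fun k => Gbar g (k, i) j) ≤ 4 * n * S := by
  have hS' : ∑ i, pathEnergy (fun k => g k i) ≤ S := Finset.sum_comm.trans_le hS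
  calc ∑ i, ∑ j, pathEnergy (fun k => Gbar g (k, i) j)
      ≤ ∑ i, ∑ j, (2 * pathEnergy (fun k => g k i) + 2 * pathEnergy fun k => g k j) :=
        Finset.sum_le_sum fun i _ => Finset.sum_le_sum fun j _ => pathEnergy_Gbar_le hg i j
    _ = 4 * n * ∑ i, pathEnergy (fun k => g k i) := by
        simp only [Finset.sum_add_distrib, Finset.sum_const, Finset.card_univ, Fintype.card_fin,
          nsmul_eq_mul, ← Finset.mul_sum]
        ring
    _ ≤ 4 * n * S := by gcongr

lemma frobSq_one_sub_proj_mul_Gbar_le {S : ℝ} (hv : IsSortedEigenbasis lam v)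
    (hg : ∀ k i, ‖g k i‖ ≤ 1) (hS : SignalSmooth g S) {τ : ℕ} (hτ : 0 < τ) :
    frobSq ((1 - proj v τ n) * Gbar g) ≤ 16 * n * (T : ℝ) ^ 2 * S / (τ : ℝ) ^ 2 := by
  calc frobSq ((1 - proj v τ n) * Gbar g)
      ≤ 4 * (T : ℝ) ^ 2 / (τ : ℝ) ^ 2 * ∑ i, ∑ j, pathEnergy fun k => Gbar g (k, i) j :=
        hv.frobSq_one_sub_proj_mul_le hτ _
    _ ≤ 4 * (T : ℝ) ^ 2 / (τ : ℝ) ^ 2 * (4 * n * S) := by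
        gcongr
        exact sum_pathEnergy_Gbar_le hg hS
    _ = 16 * n * (T : ℝ) ^ 2 * S / (τ : ℝ) ^ 2 := by ring

end Bias

/-! ### A single measurement -/

section Measurement

lemma Qber_nonneg (x : I) : 0 ≤ Qber x :=
  Real.iSup_nonneg fun q => mul_nonneg (Real.rpow_nonneg (zero_le_one.trans q.2) _)
    (Real.rpow_nonneg (integral_nonneg fun _ => Real.rpow_nonneg (abs_nonneg _) _) _)

open Classical in
/-- The centred indicator `1_a - x` of an event `a` of probability `x`. -/
noncomputable def centeredIndicator (x : I) (a : Prop) : ℝ := (if a then 1 else 0) - x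

lemma abs_centeredIndicator_le_one (x : I) (a : Prop) : |centeredIndicator x a| ≤ 1 := by
  have h0 := x.2.1
  have h1 := x.2.2
  unfold centeredIndicator
  split_ifs <;> exact abs_le.2 ⟨by linarith, by linarith⟩

lemma psi2Norm_centeredIndicator (x : I) :
    psi2Norm (bernoulliMeasure True False x) (centeredIndicator x) = Qber x := by
  simp only [psi2Norm, Qber, integral_bernoulliMeasure, centeredIndicator, if_true, if_false, id,
    zero_sub]

lemma hasSubgaussianMoments_centeredIndicator (x : I) :
    HasSubgaussianMoments (centeredIndicator x) (2 * Qber x ^ 2)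
      (bernoulliMeasure True False x) := by
  rw [← psi2Norm_centeredIndicator]
  exact hasSubgaussianMoments_psi2Norm
    (integrable_bernoulliMeasure _ _ _ _).aestronglyMeasurable
    (.of_forall (abs_centeredIndicator_le_one x))

instance : IsProbabilityMeasure unifAngle := by
  refine cond_isProbabilityMeasure_of_finite ?_ ?_
  · simp [Real.pi_pos]
  · rw [Real.volume_Ico]
    exact ENNReal.ofReal_ne_top

lemma integral_exp_unifAngle :
    ∫ x : ℝ, Complex.exp (Complex.I * (x : ℂ)) ∂unifAngle = 0 := by
  have hperiod : Complex.exp (Complex.I * ((2 * Real.pi : ℝ) : ℂ)) = 1 := by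
    push_cast
    rw [mul_comm, Complex.exp_two_pi_mul_I]
  rw [unifAngle, ProbabilityTheory.cond, integral_smul_measure, integral_Ico_eq_integral_Ioc,
    ← intervalIntegral.integral_of_le (by positivity), integral_exp_mul_complex Complex.I_ne_zero,
    hperiod]
  simp

/-- The law of the triple (edge, outlier, angle) belonging to one pair at one time. -/
noncomputable def pairLaw (p η : I) : Measure (Prop × Prop × ℝ) :=
  (bernoulliMeasure True False p).prod ((bernoulliMeasure True False η).prod unifAngle)

instance (p η : I) : IsProbabilityMeasure (pairLaw p η) := by
  unfold pairLaw
  infer_instance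

lemma measurePreserving_edge (p η : I) :
    MeasurePreserving Prod.fst (pairLaw p η) (bernoulliMeasure True False p) :=
  measurePreserving_fst

lemma measurePreserving_outlier (p η : I) :
    MeasurePreserving (fun y : Prop × Prop × ℝ => y.2.1) (pairLaw p η)
      (bernoulliMeasure True False η) :=
  measurePreserving_fst.comp measurePreserving_snd

open Classical in
/-- The measurement as a function of the triple (edge, outlier, angle) and of the true value `h`. -/
noncomputable def measurement (h : ℂ) (y : Prop × Prop × ℝ) : ℂ :=
  if y.1 then if y.2.1 then Complex.exp (Complex.I * (y.2.2 : ℂ)) else h else 0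

lemma measurable_measurement (h : ℂ) : Measurable (measurement h) := by
  unfold measurement
  refine Measurable.ite (measurableSet_setOfPred.2 measurable_fst) (Measurable.ite
    (measurableSet_setOfPred.2 (measurable_fst.comp measurable_snd)) ?_ measurable_const)
    measurable_const
  fun_prop

variable {h : ℂ} (hh : ‖h‖ ≤ 1) (p η : I)
include hh

lemma norm_measurement_le_one (y : Prop × Prop × ℝ) : ‖measurement h y‖ ≤ 1 := by
  unfold measurement
  split_ifs
  · rw [mul_comm, Complex.norm_exp_ofReal_mul_I]
  · exact hh
  · simp

lemma integrable_measurement : Integrable (measurement h) (pairLaw p η) :=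
  .of_bound (measurable_measurement h).aestronglyMeasurable 1
    (.of_forall (norm_measurement_le_one hh))

lemma integral_measurement :
    ∫ y, measurement h y ∂(pairLaw p η) = (((1 - (η : ℝ)) * (p : ℝ) : ℝ) : ℂ) * h := by
  have hint : Integrable (fun y : Prop × ℝ => measurement h (True, y))
      ((bernoulliMeasure True False η).prod unifAngle) :=
    .of_bound ((measurable_measurement h).comp measurable_prodMk_left).aestronglyMeasurable 1
      (.of_forall fun y => norm_measurement_le_one hh _)
  rw [pairLaw, integral_prod _ (integrable_measurement hh p η), integral_bernoulliMeasure,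
    integral_prod _ hint, integral_bernoulliMeasure]
  simp only [measurement, if_true, if_false, integral_exp_unifAngle]
  simp
  ring

lemma norm_measurement_sub_le (y : Prop × Prop × ℝ) :
    ‖measurement h y - (((1 - (η : ℝ)) * (p : ℝ) : ℝ) : ℂ) * h‖ ≤
      |centeredIndicator p y.1| + η + 2 * |centeredIndicator η y.2.1| := by
  have hp0 := p.2.1
  have hp1 := p.2.2
  have hη0 := η.2.1
  have hη1 := η.2.2
  set d : ℝ := (1 - (η : ℝ)) * (p : ℝ)
  have hd0 : 0 ≤ d := mul_nonneg (by linarith) hp0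
  have hdh : ‖(d : ℂ) * h‖ ≤ d := by
    rw [norm_mul, Complex.norm_real, Real.norm_of_nonneg hd0]
    exact mul_le_of_le_one_right hd0 hh
  unfold measurement centeredIndicator
  split_ifs with hedge hout
  · have hexp : ‖Complex.exp (Complex.I * (y.2.2 : ℂ))‖ = 1 := by
      rw [mul_comm, Complex.norm_exp_ofReal_mul_I]
    rw [abs_of_nonneg (by linarith), abs_of_nonneg (by linarith)]
    refine (norm_sub_le _ _).trans ?_
    nlinarith
  · have hd1 : 0 ≤ 1 - d := by nlinarith
    have hfactor : h - d * h = ((1 - d : ℝ) : ℂ) * h := by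
      push_cast
      ring
    rw [hfactor, norm_mul, Complex.norm_real, Real.norm_of_nonneg hd1, zero_sub, abs_neg,
      abs_of_nonneg (by linarith), abs_of_nonneg hη0]
    nlinarith [mul_le_of_le_one_right hd1 hh]
  all_goals
    rw [zero_sub, norm_neg, zero_sub, abs_neg, abs_of_nonneg hp0]
    nlinarith [abs_nonneg (1 - (η : ℝ)), abs_nonneg (0 - (η : ℝ))]

variable {p η} {Q : ℝ} (hp : Qber p ≤ Q) (hη : Qber η ≤ Q) (hηQ : (η : ℝ) ≤ Q)
  {ψ : ℂ →L[ℝ] ℝ} (hψ : ‖ψ‖ ≤ 1)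
include hp hη hηQ hψ

lemma hasSubgaussianMoments_measurement_sub :
    HasSubgaussianMoments
      (fun y => ψ (measurement h y - (((1 - (η : ℝ)) * (p : ℝ) : ℝ) : ℂ) * h)) (32 * Q ^ 2)
      (pairLaw p η) := by
  have hη0 := η.2.1
  have hcentered {x : I} (hx : Qber x ≤ Q) :
      HasSubgaussianMoments (fun a => |centeredIndicator x a|) (2 * Q ^ 2)
        (bernoulliMeasure True False x) := by
    have := Qber_nonneg x
    exact (hasSubgaussianMoments_centeredIndicator x).mono
      (integrable_bernoulliMeasure _ _ _ _).aestronglyMeasurable (fun _ => (abs_abs _).le)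
      (by gcongr)
  have hedge := (hcentered hp).comp_measurePreserving (measurePreserving_edge p η)
  have hout := ((hcentered hη).comp_measurePreserving (measurePreserving_outlier p η)).const_mul 2
  have hconst := (HasSubgaussianMoments.const (P := pairLaw p η) (η : ℝ)).mono
    (K' := 2 * Q ^ 2) aestronglyMeasurable_const (fun _ => le_rfl) (by nlinarith)
  have hedge_const := (hedge.add hconst).mono (K' := 2 ^ 2 * (2 * Q ^ 2))
    (hedge.add hconst).aestronglyMeasurable (fun _ => le_rfl) (by linarith)
  refine (hedge_const.add hout).mono ?_ (fun y => ?_) (by linarith)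
  · exact (ψ.continuous.measurable.comp
      ((measurable_measurement h).sub_const _)).aestronglyMeasurable
  · calc |ψ (measurement h y - (((1 - (η : ℝ)) * (p : ℝ) : ℝ) : ℂ) * h)|
        ≤ ‖measurement h y - (((1 - (η : ℝ)) * (p : ℝ) : ℝ) : ℂ) * h‖ :=
          (ψ.le_of_opNorm_le hψ _).trans_eq (one_mul _)
      _ ≤ _ := (norm_measurement_sub_le hh p η y).trans (le_abs_self _)

lemma hasSubgaussianMGF_measurement_sub :
    HasSubgaussianMGF (fun y => ψ (measurement h y - (((1 - (η : ℝ)) * (p : ℝ) : ℝ) : ℂ) * h))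
      (5 * (32 * Q ^ 2 * Real.exp 1)).toNNReal (pairLaw p η) := by
  refine (hasSubgaussianMoments_measurement_sub hh hp hη hηQ hψ).hasSubgaussianMGF ?_
  have hint := integrable_measurement hh p η
  rw [ContinuousLinearMap.integral_comp_comm (φ := fun y => measurement h y - _) ψ
      (hint.sub (integrable_const _)), integral_sub hint (integrable_const _),
    integral_measurement hh, integral_const, probReal_univ, one_smul, sub_self, map_zero]

end Measurement

/-! ### The noise -/

section Noise

variable {Ω : Type*} {n T : ℕ}

/-- The triple (edge, outlier, angle) belonging to one pair at one time. -/
def ingredients (H : Fin T → Ω → SimpleGraph (Fin n)) (outlier : PairIdx n T → Ω → Prop)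
    (φ : PairIdx n T → Ω → ℝ) (e : PairIdx n T) (ω : Ω) : Prop × Prop × ℝ :=
  ((H e.1 ω).Adj e.2.1.1 e.2.1.2, outlier e ω, φ e ω)

/-- The noise matrix `A - D Ḡ`. -/
noncomputable def noise (g : Fin T → Fin n → ℂ) (η : I) (p : Fin T → I)
    (H : Fin T → Ω → SimpleGraph (Fin n)) (outlier : PairIdx n T → Ω → Prop)
    (φ : PairIdx n T → Ω → ℝ) (ω : Ω) : Matrix (Fin T × Fin n) (Fin n) ℂ :=
  obs g H outlier φ ω - Dmat n η p * Gbar g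

variable {g : Fin T → Fin n → ℂ} {η : I} {p : Fin T → I} {H : Fin T → Ω → SimpleGraph (Fin n)}
  {outlier : PairIdx n T → Ω → Prop} {φ : PairIdx n T → Ω → ℝ}

lemma Dmat_mul_Gbar_apply (k : Fin T) (i j : Fin n) :
    (Dmat n η p * Gbar g) (k, i) j = (((1 - (η : ℝ)) * (p k : ℝ) : ℝ) : ℂ) *
      (g k i * star (g k j) - (1 : Matrix (Fin n) (Fin n) ℂ) i j) := by
  rw [Dmat, Matrix.diagonal_mul]
  rfl

lemma noise_of_lt {i j : Fin n} (h : i < j) (k : Fin T) (ω : Ω) :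
    noise g η p H outlier φ ω (k, i) j =
      measurement (g k i * star (g k j)) (ingredients H outlier φ (k, ⟨(i, j), h⟩) ω) -
        (((1 - (η : ℝ)) * (p k : ℝ) : ℝ) : ℂ) * (g k i * star (g k j)) := by
  rw [noise, Matrix.sub_apply, Dmat_mul_Gbar_apply, Matrix.one_apply_ne h.ne, sub_zero]
  simp only [obs, Matrix.of_apply, dif_pos h]
  rfl

lemma noise_of_gt {i j : Fin n} (h : j < i) (k : Fin T) (ω : Ω) :
    noise g η p H outlier φ ω (k, i) j = star (noise g η p H outlier φ ω (k, j) i) := by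
  simp only [noise, Matrix.sub_apply, Dmat_mul_Gbar_apply, obs, Matrix.of_apply, dif_pos h,
    dif_neg h.not_gt, Matrix.one_apply_ne h.ne, Matrix.one_apply_ne h.ne', sub_zero, star_sub,
    star_mul', star_star]
  congr 2
  · exact (Complex.conj_ofReal _).symm
  · exact mul_comm _ _

lemma noise_diag {k : Fin T} {i : Fin n} (hg : ‖g k i‖ = 1) (ω : Ω) :
    noise g η p H outlier φ ω (k, i) i = 0 := by
  have hunit : g k i * star (g k i) = 1 := by
    rw [← starRingEnd_apply, Complex.mul_conj, Complex.normSq_eq_norm_sq, hg]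
    norm_num
  rw [noise, Matrix.sub_apply, Dmat_mul_Gbar_apply, Matrix.one_apply_eq, hunit, sub_self, mul_zero]
  simp only [obs, Matrix.of_apply, lt_self_iff_false, dite_false, sub_zero]

lemma iSup_Qber_nonneg : 0 ≤ ⨆ k, Qber (p k) := Real.iSup_nonneg fun _ => Qber_nonneg _

lemma Qber_le_Qtot (k : Fin T) : Qber (p k) ≤ Qtot η p := by
  have hsup := le_ciSup (f := fun k => Qber (p k)) (Set.finite_range _).bddAbove k
  have hη := η.2.1
  have hQη := Qber_nonneg η
  unfold Qtot
  linarith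

lemma Qber_outlier_le_Qtot : Qber η ≤ Qtot η p := by
  have hη := η.2.1
  have hsup := iSup_Qber_nonneg (p := p)
  unfold Qtot
  linarith

lemma outlier_le_Qtot : (η : ℝ) ≤ Qtot η p := by
  have hQη := Qber_nonneg η
  have hsup := iSup_Qber_nonneg (p := p)
  unfold Qtot
  linarith

variable [MeasurableSpace Ω]

/-- The Outliers model without any assumption on the joint law of different pairs: each pair has
the prescribed law at each time, and is independent over time. -/
structure IsTimewiseOutliersModel (P : Measure Ω) (η : I) (p : Fin T → I)
    (H : Fin T → Ω → SimpleGraph (Fin n)) (outlier : PairIdx n T → Ω → Prop)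
    (φ : PairIdx n T → Ω → ℝ) : Prop where
  hasLaw : ∀ e, HasLaw (ingredients H outlier φ e) (pairLaw (p e.1) η) P
  indep : ∀ q, iIndepFun (fun k => ingredients H outlier φ (k, q)) P

variable {P : Measure Ω}

lemma IsOutliersModel.timewise (hM : IsOutliersModel P η p H outlier φ) :
    IsTimewiseOutliersModel P η p H outlier φ where
  hasLaw e :=
    { aemeasurable := ((hM.measurable_adj e).prodMk
        ((hM.measurable_outlier e).prodMk (hM.measurable_angle e))).aemeasurable
      map_eq := hM.law e }
  indep q := hM.indep.precomp (g := fun k => (k, q)) fun _ _ h => congrArg Prod.fst h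

namespace IsTimewiseOutliersModel

variable (hM : IsTimewiseOutliersModel P η p H outlier φ)
  (v : OrthonormalBasis (Fin T) ℝ (EuclideanSpace ℝ (Fin T)))
include hM

lemma hasSubgaussianMGF_coef_noise_of_lt (hg : ∀ k i, ‖g k i‖ ≤ 1) {ψ : ℂ →L[ℝ] ℝ}
    (hψ : ‖ψ‖ ≤ 1) {i j : Fin n} (h : i < j) (l : Fin T) :
    HasSubgaussianMGF (fun ω => ψ (coef v (fun k => noise g η p H outlier φ ω (k, i) j) l))
      (5 * (32 * Qtot η p ^ 2 * Real.exp 1)).toNNReal P := by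
  have hh (k : Fin T) : ‖g k i * star (g k j)‖ ≤ 1 := by
    rw [norm_mul, norm_star]
    exact mul_le_one₀ (hg k i) (norm_nonneg _) (hg k j)
  let centred (k : Fin T) (y : Prop × Prop × ℝ) : ℝ :=
    ψ (measurement (g k i * star (g k j)) y -
      (((1 - (η : ℝ)) * (p k : ℝ) : ℝ) : ℂ) * (g k i * star (g k j)))
  have hsub (k : Fin T) : HasSubgaussianMGF
      (fun ω => centred k (ingredients H outlier φ (k, ⟨(i, j), h⟩) ω))
      (5 * (32 * Qtot η p ^ 2 * Real.exp 1)).toNNReal P := by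
    have hlaw := hM.hasLaw (k, ⟨(i, j), h⟩)
    refine HasSubgaussianMGF.of_map (X := centred k) hlaw.aemeasurable ?_
    rw [hlaw.map_eq]
    exact hasSubgaussianMGF_measurement_sub (hh k) (Qber_le_Qtot k) Qber_outlier_le_Qtot
      outlier_le_Qtot hψ
  have hindep : iIndepFun
      (fun k ω => centred k (ingredients H outlier φ (k, ⟨(i, j), h⟩) ω)) P :=
    (hM.indep _).comp centred fun k =>
      ψ.continuous.measurable.comp ((measurable_measurement _).sub_const _)
  have hcoef (ω : Ω) : ψ (coef v (fun k => noise g η p H outlier φ ω (k, i) j) l) =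
      ∑ k, v l k * centred k (ingredients H outlier φ (k, ⟨(i, j), h⟩) ω) := by
    simp only [noise_of_lt h]
    exact map_coef v (ψ : ℂ →ₗ[ℝ] ℝ) _ l
  simp only [hcoef]
  exact hasSubgaussianMGF_weighted_sum hindep hsub (sum_sq_basis v l)

lemma hasSubgaussianMGF_coef_noise [IsProbabilityMeasure P] (hg : ∀ k i, ‖g k i‖ = 1)
    {ψ : ℂ →L[ℝ] ℝ} (hψ : ‖ψ‖ ≤ 1) (i j : Fin n) (l : Fin T) :
    HasSubgaussianMGF (fun ω => ψ (coef v (fun k => noise g η p H outlier φ ω (k, i) j) l))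
      (5 * (32 * Qtot η p ^ 2 * Real.exp 1)).toNNReal P := by
  have hg' (k : Fin T) (i : Fin n) : ‖g k i‖ ≤ 1 := (hg k i).le
  rcases lt_trichotomy i j with h | rfl | h
  · exact hM.hasSubgaussianMGF_coef_noise_of_lt v hg' hψ h l
  · have hzero (ω : Ω) :
        ψ (coef v (fun k => noise g η p H outlier φ ω (k, i) i) l) = 0 := by
      simp only [noise_diag (hg _ i), coef, smul_zero, Finset.sum_const_zero, map_zero]
    simp only [hzero]
    exact
      { integrable_exp_mul t := by simp only [mul_zero, integrable_const]
        mgf_le t := by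
          simp only [mgf, mul_zero, Real.exp_zero, integral_const, probReal_univ, one_smul]
          exact Real.one_le_exp (by positivity) }
  · let conj : ℂ →L[ℝ] ℂ := Complex.conjCLE
    have hconj : ‖ψ ∘L conj‖ ≤ 1 :=
      (ψ.opNorm_comp_le conj).trans (by rwa [Complex.conjCLE_norm, mul_one])
    convert hM.hasSubgaussianMGF_coef_noise_of_lt v hg' hconj h l using 2 with ω
    simp only [noise_of_gt h]
    exact congrArg ψ (map_coef v (conj : ℂ →ₗ[ℝ] ℂ) _ l).symm

lemma measureReal_noise_gt_le [IsProbabilityMeasure P] (hg : ∀ k i, ‖g k i‖ = 1) {δ : ℝ}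
    (hδ : 0 < δ) (hδ' : δ ≤ 1 / 2) (τ : ℕ) :
    P.real {ω | 5120 / 3 * Real.exp 1 * (n : ℝ) ^ 2 * τ * (Qtot η p ^ 2 * Real.log (1 / δ)) <
      ∑ i, ∑ j, ∑ l ∈ lowIdx T τ,
        ‖coef v (fun k => noise g η p H outlier φ ω (k, i) j) l‖ ^ 2} ≤ δ := by
  let part : Fin 2 → ℂ →L[ℝ] ℝ := ![Complex.reCLM, Complex.imCLM]
  have hpart : ∀ b, ‖part b‖ ≤ 1 :=
    Fin.forall_fin_two.2 ⟨Complex.reCLM_norm.le, Complex.imCLM_norm.le⟩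
  have htail := measureReal_sum_sq_gt_le_of_hasSubgaussianMGF
    (A := (Finset.univ : Finset (Fin n × Fin n)) ×ˢ lowIdx T τ ×ˢ (Finset.univ : Finset (Fin 2)))
    hδ fun a _ => hM.hasSubgaussianMGF_coef_noise v hg (hpart a.2.2) a.1.1 a.1.2 a.2.1
  refine (measureReal_mono ?_).trans htail
  intro ω hω
  rw [Set.mem_ofPred_eq] at hω ⊢
  refine lt_of_le_of_lt ?_ (hω.trans_eq ?_)
  · have hlow : ((lowIdx T τ).card : ℝ) ≤ τ := by exact_mod_cast card_lowIdx_le T τ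
    have hlog2 : Real.log 2 ≤ Real.log (1 / δ) :=
      Real.log_le_log two_pos ((le_div_iff₀ hδ).2 (by linarith))
    have hlog : Real.log (2 / δ) ≤ 2 * Real.log (1 / δ) := by
      rw [← mul_one_div, Real.log_mul two_ne_zero (by positivity)]
      linarith
    rw [Real.coe_toNNReal _ (by positivity)]
    simp only [Finset.card_product, Finset.card_univ, Fintype.card_prod, Fintype.card_fin]
    push_cast
    have : 0 ≤ 5 * (32 * Qtot η p ^ 2 * Real.exp 1) := by positivity
    have hlog0 : 0 ≤ Real.log (2 / δ) :=
      Real.log_nonneg ((le_div_iff₀ hδ).2 (by linarith))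
    calc _ ≤ (n : ℝ) * n * (τ * 2) *
          (8 / 3 * (5 * (32 * Qtot η p ^ 2 * Real.exp 1)) * (2 * Real.log (1 / δ))) := by gcongr
      _ = _ := by ring
  · simp only [Finset.sum_product, Fintype.sum_prod_type, Fin.sum_univ_two,
      sq_norm_eq_re_sq_add_im_sq]
    rfl

end IsTimewiseOutliersModel

end Noise

/-! ### The truncation level and the bounds -/

section Bounds

lemma rpow_div_three_pow_three {x : ℝ} (hx : 0 ≤ x) (k : ℕ) : (x ^ (k / 3 : ℝ)) ^ 3 = x ^ k := by
  rw [← Real.rpow_mul_natCast hx, Nat.cast_ofNat, div_mul_cancel₀ _ three_ne_zero,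
    Real.rpow_natCast]

lemma rpow_one_third_sq {x : ℝ} (hx : 0 ≤ x) : (x ^ (1 / 3 : ℝ)) ^ 2 = x ^ (2 / 3 : ℝ) := by
  rw [← Real.rpow_mul_natCast hx]
  norm_num

variable {n T : ℕ} {η : I} {p : Fin T → I} {μ S δ : ℝ}

lemma SignalSmooth.nonneg {g : Fin T → Fin n → ℂ} (hS : SignalSmooth g S) : 0 ≤ S :=
  (Finset.sum_nonneg fun _ _ => Finset.sum_nonneg fun _ _ => sq_nonneg _).trans hS

lemma fVar_nonneg : 0 ≤ fVar η p := by
  have hp : 0 ≤ pMax p := Real.iSup_nonneg fun k => (p k).2.1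
  have hV : 0 ≤ Vmax p := Real.iSup_nonneg fun k =>
    mul_nonneg (p k).2.1 (sub_nonneg.2 (p k).2.2)
  have hη0 : (0 : ℝ) ≤ η := η.2.1
  have hη1 : (0 : ℝ) ≤ 1 - η := sub_nonneg.2 η.2.2
  unfold fVar
  positivity

lemma Qtot_sq_mul_log_le_fTilde : Qtot η p ^ 2 * Real.log (1 / δ) ≤ fTilde η p δ :=
  le_add_of_nonneg_left fVar_nonneg

section Nonneg

variable (hδ : 0 < δ) (hδ' : δ ≤ 1)
include hδ hδ'

lemma Qtot_sq_mul_log_nonneg : 0 ≤ Qtot η p ^ 2 * Real.log (1 / δ) :=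
  mul_nonneg (sq_nonneg _) (Real.log_nonneg ((one_le_div hδ).2 hδ'))

lemma fTilde_nonneg : 0 ≤ fTilde η p δ :=
  (Qtot_sq_mul_log_nonneg hδ hδ').trans Qtot_sq_mul_log_le_fTilde

lemma ratio_nonneg (hμ : 0 ≤ μ) (hS : 0 ≤ S) : 0 ≤ ratio n η p μ S δ := by
  have hf := fTilde_nonneg (η := η) (p := p) hδ hδ'
  unfold ratio
  positivity

end Nonneg

lemma tauStar_pos (hT : 0 < T) : 0 < tauStar n η p μ S δ := by
  unfold tauStar
  split_ifs
  · exact hT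
  · exact lt_min (by lia) hT

lemma tauStar_le : tauStar n η p μ S δ ≤ T := by
  unfold tauStar
  split_ifs
  · exact le_rfl
  · exact min_le_right _ _

lemma tauStar_eq_of_lt (h : tauStar n η p μ S δ < T) :
    tauStar n η p μ S δ = 1 + ⌊ratio n η p μ S δ ^ (1 / 3 : ℝ)⌋₊ := by
  unfold tauStar at h ⊢
  split_ifs at h ⊢ with hf
  · exact absurd h (lt_irrefl _)
  · exact min_eq_left ((min_lt_iff.1 h).resolve_right (lt_irrefl _)).le

lemma one_add_ratio_rpow_le_of_tauStar_lt (hρ : 0 ≤ ratio n η p μ S δ)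
    (h : tauStar n η p μ S δ < T) :
    1 + ratio n η p μ S δ ^ (2 / 3 : ℝ) ≤ 2 * (tauStar n η p μ S δ : ℝ) ^ 2 := by
  have hfloor := Nat.lt_floor_add_one (ratio n η p μ S δ ^ (1 / 3 : ℝ))
  have hroot := Real.rpow_nonneg hρ (1 / 3 : ℝ)
  rw [← rpow_one_third_sq hρ, tauStar_eq_of_lt h]
  push_cast
  nlinarith [Nat.cast_nonneg (α := ℝ) ⌊ratio n η p μ S δ ^ (1 / 3 : ℝ)⌋₊]

lemma tauStar_le_min (hρ : 0 ≤ ratio n η p μ S δ) (hf : fTilde η p δ ≠ 0) :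
    (tauStar n η p μ S δ : ℝ) ≤ min (1 + ratio n η p μ S δ ^ (1 / 3 : ℝ)) T := by
  rw [tauStar, if_neg hf, Nat.cast_min, Nat.cast_add, Nat.cast_one]
  gcongr
  exact Nat.floor_le (Real.rpow_nonneg hρ _)

lemma noise_level_le {C : ℝ} (hC : 0 ≤ C) (hμ : 0 ≤ μ) (hS : 0 ≤ S) (hδ : 0 < δ) (hδ' : δ ≤ 1) :
    C * (n : ℝ) ^ 2 * tauStar n η p μ S δ * (Qtot η p ^ 2 * Real.log (1 / δ)) ≤
      C * fTilde η p δ * (n : ℝ) ^ 2 * min (1 + ratio n η p μ S δ ^ (1 / 3 : ℝ)) T := by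
  have hρ := ratio_nonneg (n := n) (η := η) (p := p) hδ hδ' hμ hS
  have hQ := Qtot_sq_mul_log_le_fTilde (η := η) (p := p) (δ := δ)
  have hQ0 := Qtot_sq_mul_log_nonneg (η := η) (p := p) hδ hδ'
  by_cases hf : fTilde η p δ = 0
  · rw [le_antisymm (hQ.trans hf.le) hQ0, hf]
    simp
  · have hτ := tauStar_le_min hρ hf
    calc _ ≤ C * (n : ℝ) ^ 2 * min (1 + ratio n η p μ S δ ^ (1 / 3 : ℝ)) T * fTilde η p δ := by
          gcongr
      _ = _ := by ring

lemma frobSq_one_sub_proj_full (v : OrthonormalBasis (Fin T) ℝ (EuclideanSpace ℝ (Fin T)))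
    (Y : Matrix (Fin T × Fin n) (Fin n) ℂ) : frobSq ((1 - proj v T n) * Y) = 0 := by
  have hlow : lowIdx T T = Finset.univ :=
    Finset.eq_univ_of_forall fun l => mem_lowIdx.2 (Nat.le_add_left _ _)
  rw [frobSq_one_sub_proj_mul, hlow]
  simp only [Finset.compl_univ, Finset.sum_empty, Finset.sum_const_zero]

lemma frobSq_one_sub_proj_tauStar_le {g : Fin T → Fin n → ℂ} {lam : Fin T → ℝ}
    {v : OrthonormalBasis (Fin T) ℝ (EuclideanSpace ℝ (Fin T))} (hT : 0 < T)
    (hg : ∀ k i, ‖g k i‖ ≤ 1) (hS : SignalSmooth g S) (hv : IsSortedEigenbasis lam v) (hμ : 0 ≤ μ)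
    (hD : DSmooth v g η p μ) (hδ : 0 < δ) (hδ' : δ ≤ 1) :
    frobSq ((1 - proj v (tauStar n η p μ S δ) n) * (Dmat n η p * Gbar g)) ≤
      if tauStar n η p μ S δ < T then
        32 * max (μ * dBar η p ^ 2 * n * (T : ℝ) ^ 2 * S /
          (1 + ratio n η p μ S δ ^ (2 / 3 : ℝ))) (μ * dBar η p ^ 2 * n * S)
      else 0 := by
  have hS0 := hS.nonneg
  have hρ := ratio_nonneg (n := n) (η := η) (p := p) hδ hδ' hμ hS0
  have hτ := tauStar_pos (n := n) (η := η) (p := p) (μ := μ) (S := S) (δ := δ) hT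
  split_ifs with h
  · have : (0 : ℝ) < tauStar n η p μ S δ := by exact_mod_cast hτ
    have hρτ := one_add_ratio_rpow_le_of_tauStar_lt hρ h
    have := Real.rpow_nonneg hρ (2 / 3 : ℝ)
    calc _ ≤ μ * dBar η p ^ 2 * frobSq ((1 - proj v (tauStar n η p μ S δ) n) * Gbar g) :=
          hD _ hτ tauStar_le
      _ ≤ μ * dBar η p ^ 2 *
            (16 * n * (T : ℝ) ^ 2 * S / (tauStar n η p μ S δ : ℝ) ^ 2) := by
          gcongr
          exact frobSq_one_sub_proj_mul_Gbar_le hv hg hS hτ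
      _ = 32 * (μ * dBar η p ^ 2 * n * (T : ℝ) ^ 2 * S /
            (2 * (tauStar n η p μ S δ : ℝ) ^ 2)) := by
          field_simp
          ring
      _ ≤ 32 * (μ * dBar η p ^ 2 * n * (T : ℝ) ^ 2 * S /
            (1 + ratio n η p μ S δ ^ (2 / 3 : ℝ))) := by gcongr
      _ ≤ _ := by
          gcongr
          exact le_max_left _ _
  · rw [tauStar_le.antisymm (not_lt.1 h), frobSq_one_sub_proj_full]

section Balanced

variable (hn : 0 < n) (hf : 0 < fTilde η p δ)
include hn hf

lemma mul_eq_fTilde_mul_ratio :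
    μ * dBar η p ^ 2 * n * (T : ℝ) ^ 2 * S =
      fTilde η p δ * (n : ℝ) ^ 2 * ratio n η p μ S δ := by
  unfold ratio
  field_simp

lemma simpleBound_eq (hμ : 0 ≤ μ) (hS : 0 ≤ S) (C : ℝ) :
    simpleBound C n η p μ S δ =
      C * (fTilde η p δ * (n : ℝ) ^ 2 * ratio n η p μ S δ ^ (1 / 3 : ℝ)) := by
  have hm : 0 ≤ μ * dBar η p ^ 2 := by positivity
  have hρ : 0 ≤ ratio n η p μ S δ := by
    unfold ratio
    positivity
  have hcube {x : ℝ} (hx : 0 ≤ x) : (x ^ (1 / 3 : ℝ)) ^ 3 = x := by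
    simpa using rpow_div_three_pow_three hx 1
  have hcube_two {x : ℝ} (hx : 0 ≤ x) : (x ^ (2 / 3 : ℝ)) ^ 3 = x ^ 2 :=
    mod_cast rpow_div_three_pow_three hx 2
  have hcube_five {x : ℝ} (hx : 0 ≤ x) : (x ^ (5 / 3 : ℝ)) ^ 3 = x ^ 5 :=
    mod_cast rpow_div_three_pow_three hx 5
  have hprod : fTilde η p δ ^ (2 / 3 : ℝ) * (μ * dBar η p ^ 2) ^ (1 / 3 : ℝ) *
      (n : ℝ) ^ (5 / 3 : ℝ) * (T : ℝ) ^ (2 / 3 : ℝ) * S ^ (1 / 3 : ℝ) =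
      fTilde η p δ * (n : ℝ) ^ 2 * ratio n η p μ S δ ^ (1 / 3 : ℝ) := by
    refine (pow_left_inj₀ (by positivity) (by positivity) three_ne_zero).1 ?_
    simp only [mul_pow _ _ 3, hcube hm, hcube hS, hcube hρ, hcube_two hf.le,
      hcube_two T.cast_nonneg, hcube_five n.cast_nonneg]
    linear_combination fTilde η p δ ^ 2 * (n : ℝ) ^ 4 *
      mul_eq_fTilde_mul_ratio (μ := μ) (S := S) hn hf
  rw [← hprod]
  unfold simpleBound
  ring

lemma max_bias_le (hμ : 0 ≤ μ) (hS : 0 ≤ S) (hρT : ratio n η p μ S δ ≤ (T : ℝ) ^ 3) (hT : 0 < T) :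
    max (μ * dBar η p ^ 2 * n * (T : ℝ) ^ 2 * S / (1 + ratio n η p μ S δ ^ (2 / 3 : ℝ)))
        (μ * dBar η p ^ 2 * n * S) ≤
      fTilde η p δ * (n : ℝ) ^ 2 * ratio n η p μ S δ ^ (1 / 3 : ℝ) := by
  have hρ : 0 ≤ ratio n η p μ S δ := by
    unfold ratio
    positivity
  have hbalance := mul_eq_fTilde_mul_ratio (μ := μ) (S := S) hn hf
  set r := ratio n η p μ S δ ^ (1 / 3 : ℝ) with hr
  have hr0 : 0 ≤ r := Real.rpow_nonneg hρ _
  have hr3 : r ^ 3 = ratio n η p μ S δ := by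
    simpa [hr] using rpow_div_three_pow_three hρ 1
  have hrT : r ≤ T := by
    rw [← hr3] at hρT
    exact le_of_pow_le_pow_left₀ three_ne_zero T.cast_nonneg hρT
  rw [← rpow_one_third_sq hρ, ← hr]
  rw [← hr3] at hbalance
  refine max_le ?_ (le_of_mul_le_mul_right ?_ (by positivity : (0 : ℝ) < (T : ℝ) ^ 2))
  · rw [hbalance, div_le_iff₀ (by positivity)]
    nlinarith [mul_nonneg (mul_nonneg hf.le (sq_nonneg (n : ℝ))) hr0]
  · calc μ * dBar η p ^ 2 * n * S * (T : ℝ) ^ 2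
        = fTilde η p δ * (n : ℝ) ^ 2 * r * r ^ 2 := by linear_combination hbalance
      _ ≤ fTilde η p δ * (n : ℝ) ^ 2 * r * (T : ℝ) ^ 2 := by gcongr

lemma generalBound_le_simpleBound {C₂ C₃ : ℝ} (hC₂ : 0 ≤ C₂) (hC₃ : 0 ≤ C₃) (hT : 0 < T)
    (hμ : 0 < μ) (hd : 0 < dBar η p) (hS : 0 < S)
    (hlow : (n * fTilde η p δ / (μ * dBar η p ^ 2 * S)) ^ (1 / 2 : ℝ) ≤ T)
    (hhigh : μ * dBar η p ^ 2 * S / (n * fTilde η p δ) ≤ T) :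
    generalBound C₂ C₃ n η p μ S δ ≤ simpleBound (C₂ + 2 * C₃) n η p μ S δ := by
  have hρ1 : 1 ≤ ratio n η p μ S δ := by
    rw [← Real.sqrt_eq_rpow, Real.sqrt_le_left T.cast_nonneg, div_le_iff₀ (by positivity)] at hlow
    rw [ratio, one_le_div (by positivity)]
    linarith
  have hρT : ratio n η p μ S δ ≤ (T : ℝ) ^ 3 := by
    calc ratio n η p μ S δ
        = μ * dBar η p ^ 2 * S / (n * fTilde η p δ) * (T : ℝ) ^ 2 := by
          unfold ratio
          ring
      _ ≤ T * (T : ℝ) ^ 2 := by gcongr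
      _ = (T : ℝ) ^ 3 := by ring
  have hr1 : 1 ≤ ratio n η p μ S δ ^ (1 / 3 : ℝ) := Real.one_le_rpow hρ1 (by norm_num)
  have hbias := max_bias_le hn hf hμ.le hS.le hρT hT
  have hmin : min (1 + ratio n η p μ S δ ^ (1 / 3 : ℝ)) T ≤
      2 * ratio n η p μ S δ ^ (1 / 3 : ℝ) := (min_le_left _ _).trans (by linarith)
  rw [simpleBound_eq hn hf hμ.le hS.le, generalBound, add_mul]
  refine add_le_add ?_ ?_
  · split_ifs
    · gcongr
    · positivity
  · calc _ ≤ C₃ * fTilde η p δ * (n : ℝ) ^ 2 * (2 * ratio n η p μ S δ ^ (1 / 3 : ℝ)) := by gcongr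
      _ = _ := by ring

end Balanced

end Bounds

lemma sqError_eq_noise_add_bias {Ω : Type*} {n T : ℕ}
    (v : OrthonormalBasis (Fin T) ℝ (EuclideanSpace ℝ (Fin T))) (g : Fin T → Fin n → ℂ) (η : I)
    (p : Fin T → I) (μ S δ : ℝ) (H : Fin T → Ω → SimpleGraph (Fin n))
    (outlier : PairIdx n T → Ω → Prop) (φ : PairIdx n T → Ω → ℝ) (ω : Ω) :
    sqError v g η p μ S δ H outlier φ ω =
      (∑ i, ∑ j, ∑ l ∈ lowIdx T (tauStar n η p μ S δ),
        ‖coef v (fun k => noise g η p H outlier φ ω (k, i) j) l‖ ^ 2) +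
      frobSq ((1 - proj v (tauStar n η p μ S δ) n) * (Dmat n η p * Gbar g)) :=
  frobSq_proj_mul_sub v _ _ _

lemma IsTimewiseOutliersModel.generalBound_probability {n T : ℕ} (hT : 0 < T)
    {g : Fin T → Fin n → ℂ} (hg : ∀ k i, ‖g k i‖ = 1) {S : ℝ} (hS : SignalSmooth g S)
    {lam : Fin T → ℝ} {v : OrthonormalBasis (Fin T) ℝ (EuclideanSpace ℝ (Fin T))}
    (hv : IsSortedEigenbasis lam v) {η : I} {p : Fin T → I} {μ : ℝ} (hμ : 0 ≤ μ)
    (hD : DSmooth v g η p μ) {Ω : Type*} [MeasurableSpace Ω] {P : Measure Ω}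
    [IsProbabilityMeasure P] {H : Fin T → Ω → SimpleGraph (Fin n)}
    {outlier : PairIdx n T → Ω → Prop} {φ : PairIdx n T → Ω → ℝ}
    (hM : IsTimewiseOutliersModel P η p H outlier φ) {δ : ℝ} (hδ : 0 < δ) (hδ' : δ ≤ 1 / 2) :
    1 - δ ≤ P.real {ω | sqError v g η p μ S δ H outlier φ ω ≤
      generalBound 32 (5120 / 3 * Real.exp 1) n η p μ S δ} := by
  set good := {ω | sqError v g η p μ S δ H outlier φ ω ≤
    generalBound 32 (5120 / 3 * Real.exp 1) n η p μ S δ}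
  have hbias := frobSq_one_sub_proj_tauStar_le (δ := δ) hT (fun k i => (hg k i).le) hS hv hμ hD
    hδ (by linarith)
  have hlevel := noise_level_le (n := n) (η := η) (p := p) (C := 5120 / 3 * Real.exp 1)
    (by positivity) hμ hS.nonneg hδ (by linarith)
  have hbad : P.real goodᶜ ≤ δ := by
    refine (measureReal_mono fun ω hω => ?_).trans
      (hM.measureReal_noise_gt_le v hg hδ hδ' (tauStar n η p μ S δ))
    by_contra hnoise
    refine hω ?_
    rw [Set.mem_ofPred_eq, not_lt] at hnoise
    rw [Set.mem_ofPred_eq, sqError_eq_noise_add_bias, add_comm]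
    exact add_le_add hbias (hnoise.trans hlevel)
  have hcover := measureReal_union_le (μ := P) good goodᶜ
  rw [Set.union_compl_self, probReal_univ] at hcover
  linarith

theorem mainTheorem2_general {n T : ℕ} (hn : 0 < n) (hT : 0 < T) {g : Fin T → Fin n → ℂ}
    (hg : ∀ k i, ‖g k i‖ = 1) {S : ℝ} (hS : SignalSmooth g S) {lam : Fin T → ℝ}
    {v : OrthonormalBasis (Fin T) ℝ (EuclideanSpace ℝ (Fin T))} (hv : IsSortedEigenbasis lam v)
    {η : I} {p : Fin T → I} {μ : ℝ} (hμ : 0 < μ) (hD : DSmooth v g η p μ)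
    {Ω : Type*} [MeasurableSpace Ω] {P : Measure Ω} [IsProbabilityMeasure P]
    {H : Fin T → Ω → SimpleGraph (Fin n)} {outlier : PairIdx n T → Ω → Prop}
    {φ : PairIdx n T → Ω → ℝ} (hM : IsTimewiseOutliersModel P η p H outlier φ)
    {δ : ℝ} (hδ : 0 < δ) (hδ' : δ ≤ 1 / 2) :
    1 - δ ≤ P.real {ω | sqError v g η p μ S δ H outlier φ ω ≤
        generalBound 32 (5120 / 3 * Real.exp 1) n η p μ S δ} ∧
      (0 < fTilde η p δ → 0 < dBar η p → 0 < S →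
        max ((n * fTilde η p δ / (μ * dBar η p ^ 2 * S)) ^ (1 / 2 : ℝ))
          (μ * dBar η p ^ 2 * S / (n * fTilde η p δ)) ≤ (T : ℝ) →
        (∀ ω, sqError v g η p μ S δ H outlier φ ω ≤
            generalBound 32 (5120 / 3 * Real.exp 1) n η p μ S δ →
          sqError v g η p μ S δ H outlier φ ω ≤
            simpleBound (32 + 2 * (5120 / 3 * Real.exp 1)) n η p μ S δ) ∧
        1 - δ ≤ P.real {ω | sqError v g η p μ S δ H outlier φ ω ≤
          simpleBound (32 + 2 * (5120 / 3 * Real.exp 1)) n η p μ S δ}) := by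
  have hgeneral := hM.generalBound_probability hT hg hS hv hμ.le hD hδ hδ'
  refine ⟨hgeneral, fun hf hd hS0 hTlarge => ?_⟩
  have hle := generalBound_le_simpleBound (C₂ := 32) (C₃ := 5120 / 3 * Real.exp 1) hn hf
    (by norm_num) (by positivity) hT hμ hd hS0 (max_le_iff.1 hTlarge).1 (max_le_iff.1 hTlarge).2
  have himp : ∀ ω, _ → _ := fun ω (hω : sqError v g η p μ S δ H outlier φ ω ≤ _) => hω.trans hle
  exact ⟨himp, hgeneral.trans (measureReal_mono himp)⟩

end DynSync

open DynSync in
theorem mainTheorem2 :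
    ∃ C₁ C₂ C₃ C₄ C₅ : ℝ,
      0 < C₁ ∧ C₁ < 1 ∧ 0 < C₂ ∧ 0 < C₃ ∧ 0 < C₄ ∧ 0 < C₅ ∧
      ∀ (n T : ℕ), 1 ≤ n → 1 ≤ T →
      ∀ (g : Fin T → Fin n → ℂ), (∀ k i, ‖g k i‖ = 1) →
      ∀ (S : ℝ), SignalSmooth g S →
      ∀ (lam : Fin T → ℝ) (v : OrthonormalBasis (Fin T) ℝ (EuclideanSpace ℝ (Fin T))),
        IsSortedEigenbasis lam v →
      ∀ (η : unitInterval) (p : Fin T → unitInterval) (μ : ℝ), 1 ≤ μ → DSmooth v g η p μ →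
      ∀ (Ω : Type*) [MeasurableSpace Ω] (P : MeasureTheory.Measure Ω)
        [MeasureTheory.IsProbabilityMeasure P]
        (H : Fin T → Ω → SimpleGraph (Fin n)) (outlier : PairIdx n T → Ω → Prop)
        (φ : PairIdx n T → Ω → ℝ), IsOutliersModel P η p H outlier φ →
      ∀ (δ : ℝ), 0 < δ → δ < C₁ →
        (1 - δ ≤ P.real {ω | sqError v g η p μ S δ H outlier φ ω ≤
            generalBound C₂ C₃ n η p μ S δ}) ∧
        (0 < fTilde η p δ → 0 < dBar η p → 0 < S →
          C₄ * max ((n * fTilde η p δ / (μ * dBar η p ^ 2 * S)) ^ (1 / 2 : ℝ))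
            (μ * dBar η p ^ 2 * S / (n * fTilde η p δ)) ≤ (T : ℝ) →
          (∀ ω, sqError v g η p μ S δ H outlier φ ω ≤ generalBound C₂ C₃ n η p μ S δ →
            sqError v g η p μ S δ H outlier φ ω ≤ simpleBound C₅ n η p μ S δ) ∧
          1 - δ ≤ P.real {ω | sqError v g η p μ S δ H outlier φ ω ≤
            simpleBound C₅ n η p μ S δ}) := by
  refine ⟨1 / 2, 32, 5120 / 3 * Real.exp 1, 1, 32 + 2 * (5120 / 3 * Real.exp 1), by norm_num,
    by norm_num, by norm_num, by positivity, one_pos, by positivity, ?_⟩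
  intro n T hn hT g hg S hS lam v hv η p μ hμ hD Ω _ P _ H outlier φ hM δ hδ hδ'
  simpa only [one_mul] using mainTheorem2_general hn hT hg hS hv (one_pos.trans_le hμ) hD
    hM.timewise hδ hδ'.le
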